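/- Let $\tau\in\mathbb C$ with $\operatorname{Im}\tau>0$, let $\Omega=\operatorname{diag}(\tau,\tau)$, let $L_\Omega=\mathbb Z^2\Omega+\mathbb Z^2\subset\mathbb C^2$ and $A_\Omega=\mathbb C^2/L_\Omega$. Define $$H_\tau(z,w)=\frac1{\operatorname{Im}\tau}\,(z_1\overline{w}_1+z_2\overline{w}_2)\qquad(z,w\in\mathbb C^2),\qquad E_\tau=\operatorname{Im}H_\tau .$$ 1. The vectors $f_1=(\tau,0)$, $f_2=(0,\tau)$, $f_3=(1,0)$, $f_4=(0,1)$ are linearly independent over $\mathbb R$ and generate the group $L_\Omega$, and $$\bigl(E_\tau(f_i,f_j)\bigr)_{1\le i,j\le 4}=\begin{pmatrix}0&0&1&0\\0&0&0&1\\-1&0&0&0\\0&-1&0&0\end{pmatrix}.$$ 2. $H_\tau$ is a positive definite Riemann form for $A_\Omega$, that is, a positive definite (hence nondegenerate) Hermitian form on $\mathbb C^2$ such that $E_\tau$ is integral valued on $L_\Omega\times L_\Omega$. 3. There is a semi-character of $L_\Omega$ with respect to $E_\tau$, that is, a map $\chi:L_\Omega\to\{t\in\mathbb C:|t|=1\}$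 with $\chi(\alpha+\beta)=\chi(\alpha)\chi(\beta)e^{i\pi E_\tau(\alpha,\beta)}$ for all $\alpha,\beta\in L_\Omega$. Let $\chi_\tau$ be any such semi-character, and let $L(H_\tau,\chi_\tau)$ be the holomorphic line bundle over $A_\Omega$ which is the quotient of $\mathbb C^2\times\mathbb C$ by the action of $L_\Omega$ given by $$\alpha\cdot(z,\xi)=\Bigl(z+\alpha,\ \chi_\tau(\alpha)\,e^{\pi H_\tau(z,\alpha)+\frac{\pi}{2}H_\tau(\alpha,\alpha)}\,\xi\Bigr).$$ Then: * $L(H_\tau,\chi_\tau)$ is ample, that is, for some $n\ge1$ the global sections of $L(H_\tau,\chi_\tau)^{\otimes n}$ give an embedding of $A_\Omega$ as a closed complex submanifold of a projective space; * for every $n\ge3$ the global sections of $L(H_\tau,\chi_\tau)^{\otimes n}$ give such an embedding: for some (equivalently, any) basis $s_0,\dots,s_N$ of the space of holomorphic sections, $s_0,\dots,s_N$ have no common zero and $x\mapsto[s_0(x):\dots:s_N(x)]$ is a holomorphic embedding of $A_\Omega$ into $\mathbb P^N(\mathbb C)$ with closed image; * $\dim_{\mathbb C} H^0(A_\Omega,L(H_\tau,\chi_\tau))=1$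 (a principal polarization). -/

import Mathlib

open scoped TensorProduct ComplexConjugate LinearAlgebra.Projectivization

noncomputable section

/-- The space `ℂ²` of row vectors. -/
abbrev CC : Type := Fin 2 → ℂ

/-! ### Lattices, Hermitian forms, Riemann forms, semi-characters -/

/-- `L_Ω = ℤ² Ω + ℤ²` (row vectors). -/
def periodLattice (Ω : Matrix (Fin 2) (Fin 2) ℂ) : AddSubgroup CC where
  carrier := {v | ∃ m n : Fin 2 → ℤ,
    v = Matrix.vecMul (fun i => (m i : ℂ)) Ω + fun i => (n i : ℂ)}
  zero_mem' := ⟨0, 0, by ext j; simp [Matrix.vecMul, dotProduct]⟩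
  add_mem' := by
    rintro _ _ ⟨m, n, rfl⟩ ⟨m', n', rfl⟩
    refine ⟨m + m', n + n', ?_⟩
    ext j
    simp [Matrix.vecMul, dotProduct]
    ring
  neg_mem' := by
    rintro _ ⟨m, n, rfl⟩
    refine ⟨-m, -n, ?_⟩
    ext j
    simp [Matrix.vecMul, dotProduct]
    ring

/-- Hermitian forms on `ℂ²`, linear in the first and conjugate-linear in the second variable. -/
structure IsHermitianForm (H : CC → CC → ℂ) : Prop where
  add_left : ∀ z z' w, H (z + z') w = H z w + H z' w
  smul_left : ∀ (c : ℂ) (z w : CC), H (c • z) w = c * H z w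
  conj_symm : ∀ z w, conj (H z w) = H w z

/-- A Riemann form for `ℂ² / Λ`: a nondegenerate Hermitian form whose imaginary part is integral
on `Λ × Λ`. -/
structure IsRiemannForm (Λ : AddSubgroup CC) (H : CC → CC → ℂ) : Prop
    extends IsHermitianForm H where
  nondegenerate : ∀ z, (∀ w, H z w = 0) → z = 0
  integral : ∀ α ∈ Λ, ∀ β ∈ Λ, ∃ k : ℤ, (H α β).im = k

/-- Positive definiteness of a Hermitian form (whose values `H z z` are real). -/
def IsPosDefForm (H : CC → CC → ℂ) : Prop := ∀ z, z ≠ 0 → 0 < (H z z).re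

/-- `χ : Λ → T` is a semi-character with respect to `E = Im H`. -/
def IsSemiCharacter (Λ : AddSubgroup CC) (H : CC → CC → ℂ) (χ : Λ → Circle) : Prop :=
  ∀ α β : Λ, (χ (α + β) : ℂ) =
    χ α * χ β * Complex.exp (Complex.I * Real.pi * ((H α β).im : ℂ))

/-! ### Holomorphic line bundles on a complex torus `A = ℂ² / Λ` -/

/-- A holomorphic line bundle over `A = ℂ² / Λ`, given by its fibres and a trivialization of its
pull-back to `ℂ²`. For every `x : A` and every `z : ℂ²` over `x` there is an isomorphism
`Fiber x ≃ ℂ`, and the isomorphisms at `z` and at `z + α`, for `α` in `Λ`, differ by a scalar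
which is a holomorphic function of `z`. As `ℂ² → A` is a covering map, restricting these
isomorphisms to the sheets over small open sets gives an atlas of local trivializations of the
bundle with holomorphic transition functions. -/
structure HolLineBundle (Λ : AddSubgroup CC) where
  Fiber : CC ⧸ Λ → Type
  [addCommGroup : ∀ x, AddCommGroup (Fiber x)]
  [module : ∀ x, Module ℂ (Fiber x)]
  triv : ∀ (x : CC ⧸ Λ) (z : CC), (z : CC ⧸ Λ) = x → (Fiber x ≃ₗ[ℂ] ℂ)
  holomorphic : ∀ (α : CC) (hα : α ∈ Λ), Differentiable ℂ fun z : CC =>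
    triv (z : CC ⧸ Λ) (z + α) (QuotientAddGroup.mk_add_of_mem z hα)
      ((triv (z : CC ⧸ Λ) z rfl).symm 1)

attribute [instance] HolLineBundle.addCommGroup HolLineBundle.module

namespace HolLineBundle

variable {Λ : AddSubgroup CC}

/-- `H⁰(A, M)`: the space of holomorphic global sections. -/
def sections (M : HolLineBundle Λ) : Submodule ℂ (∀ x, M.Fiber x) where
  carrier := {s | Differentiable ℂ fun z : CC => M.triv (z : CC ⧸ Λ) z rfl (s z)}
  zero_mem' := by simp
  add_mem' := by
    intro s t hs ht
    simp only [Set.mem_ofPred_eq, Pi.add_apply, map_add] at *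
    exact hs.add ht
  smul_mem' := by
    intro c s hs
    simp only [Set.mem_ofPred_eq, Pi.smul_apply, map_smul] at *
    exact hs.const_smul c

/-- The tensor power `M^{⊗ n}`, formed fibre by fibre. -/
def tensorPower (M : HolLineBundle Λ) (n : ℕ) : HolLineBundle Λ where
  Fiber x := ⨂[ℂ]^n (M.Fiber x)
  addCommGroup _ := inferInstance
  module _ := inferInstance
  triv x z h := (PiTensorProduct.congr fun _ : Fin n => M.triv x z h).trans
    (PiTensorProduct.constantBaseRingEquiv (Fin n) ℂ).toLinearEquiv
  holomorphic α hα := by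
    have key : ∀ (x : CC ⧸ Λ) (z w : CC) (hz : (z : CC ⧸ Λ) = x) (hw : (w : CC ⧸ Λ) = x),
        ((PiTensorProduct.congr fun _ : Fin n => M.triv x w hw).trans
          (PiTensorProduct.constantBaseRingEquiv (Fin n) ℂ).toLinearEquiv)
        (((PiTensorProduct.congr fun _ : Fin n => M.triv x z hz).trans
          (PiTensorProduct.constantBaseRingEquiv (Fin n) ℂ).toLinearEquiv).symm 1) =
        (M.triv x w hw ((M.triv x z hz).symm 1)) ^ n := by
      intro x z w hz hw
      have h1 : ((PiTensorProduct.congr fun _ : Fin n => M.triv x z hz).trans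
          (PiTensorProduct.constantBaseRingEquiv (Fin n) ℂ).toLinearEquiv).symm 1 =
          PiTensorProduct.tprod ℂ fun _ : Fin n => (M.triv x z hz).symm 1 := by
        rw [LinearEquiv.symm_apply_eq]
        simp
      rw [h1]
      simp
    simp only [key]
    exact (M.holomorphic α hα).pow n

end HolLineBundle

/-! ### The line bundle `L(H, χ)` -/

/-- The automorphic factor `J(α, z) = χ(α) exp(π H(z, α) + (π / 2) H(α, α))`. -/
def autFactor {Λ : AddSubgroup CC} (H : CC → CC → ℂ) (χ : Λ → Circle) (α : Λ) (z : CC) : ℂ :=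
  χ α * Complex.exp (Real.pi * H z α + Real.pi / 2 * H α α)

theorem autFactor_ne_zero {Λ : AddSubgroup CC} (H : CC → CC → ℂ) (χ : Λ → Circle) (α : Λ)
    (z : CC) : autFactor H χ α z ≠ 0 :=
  mul_ne_zero (Circle.coe_ne_zero _) (Complex.exp_ne_zero _)

theorem autFactor_add {Λ : AddSubgroup CC} {H : CC → CC → ℂ} (hH : IsRiemannForm Λ H)
    {χ : Λ → Circle} (hχ : IsSemiCharacter Λ H χ) (α β : Λ) (z : CC) :
    autFactor H χ (α + β) z = autFactor H χ α (β + z) * autFactor H χ β z := by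
  have add_right : ∀ z w w', H z (w + w') = H z w + H z w' := by
    intro z w w'
    rw [← hH.conj_symm, hH.add_left, map_add, hH.conj_symm, hH.conj_symm]
  obtain ⟨k, hk⟩ := hH.integral α α.2 β β.2
  have h2 : H α β - H β α = 2 * Complex.I * k := by
    rw [← hH.conj_symm α β, Complex.sub_conj, hk]
    push_cast
    ring
  have h3 : H β α = H α β - 2 * Complex.I * k := by rw [← h2]; ring
  have h4 : Complex.exp (k * (2 * Real.pi * Complex.I)) = 1 :=
    Complex.exp_int_mul_two_pi_mul_I k
  unfold autFactor
  rw [hχ α β, hk]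
  simp only [AddSubgroup.coe_add, add_right, hH.add_left]
  rw [mul_assoc ((χ α : ℂ) * χ β), ← Complex.exp_add, mul_mul_mul_comm, ← Complex.exp_add, h3]
  congr 1
  conv_rhs => rw [← mul_one (Complex.exp _), ← h4, ← Complex.exp_add]
  congr 1
  push_cast
  ring

/-- The fibre over `x` of the quotient of `ℂ² × ℂ` by the action
`α • (z, ξ) = (z + α, J(α, z) ξ)` of `Λ`. A point of this fibre is an orbit of `Λ` lying over `x`,
and such an orbit is the graph of a function `f` on the preimage of `x` in `ℂ²` which satisfies
`f (z + α) = J(α, z) f z`. The linear structure is that of the values `f z`. -/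
def autFiber {Λ : AddSubgroup CC} (J : Λ → CC → ℂ) (x : CC ⧸ Λ) :
    Submodule ℂ ({z : CC // (z : CC ⧸ Λ) = x} → ℂ) where
  carrier := {f | ∀ z w : {z : CC // (z : CC ⧸ Λ) = x}, ∀ α : Λ,
    (w : CC) = z + α → f w = J α z * f z}
  zero_mem' := by intro z w α _; simp
  add_mem' := by
    intro f g hf hg z w α h
    simp only [Pi.add_apply, hf z w α h, hg z w α h]
    ring
  smul_mem' := by
    intro c f hf z w α h
    simp only [Pi.smul_apply, smul_eq_mul, hf z w α h]
    ring

/-- Evaluation at a point over `x` identifies the fibre over `x` with `ℂ`. -/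
def autTriv {Λ : AddSubgroup CC} {H : CC → CC → ℂ} (hH : IsRiemannForm Λ H)
    {χ : Λ → Circle} (hχ : IsSemiCharacter Λ H χ) (x : CC ⧸ Λ) (z : CC)
    (hz : (z : CC ⧸ Λ) = x) : autFiber (autFactor H χ) x ≃ₗ[ℂ] ℂ :=
  LinearEquiv.ofBijective
    ((LinearMap.proj (⟨z, hz⟩ : {z : CC // (z : CC ⧸ Λ) = x})).comp (Submodule.subtype _)) <| by
    have sub_mem : ∀ w : {z : CC // (z : CC ⧸ Λ) = x}, (w : CC) - z ∈ Λ := by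
      intro w
      have h : (z : CC ⧸ Λ) = ((w : CC) : CC ⧸ Λ) := hz.trans w.2.symm
      rw [QuotientAddGroup.eq] at h
      rwa [sub_eq_neg_add]
    constructor
    · rintro ⟨f, hf⟩ ⟨g, hg⟩ h
      ext w
      have h' : f ⟨z, hz⟩ = g ⟨z, hz⟩ := h
      have e : (w : CC) = z + (⟨w - z, sub_mem w⟩ : Λ) := by simp
      change f w = g w
      rw [hf ⟨z, hz⟩ w _ e, hg ⟨z, hz⟩ w _ e, h']
    · intro c
      have h0 : autFactor H χ 0 z = 1 := by
        have := autFactor_add hH hχ 0 0 z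
        rw [add_zero, AddSubgroup.coe_zero, zero_add] at this
        exact (mul_eq_left₀ (autFactor_ne_zero H χ 0 z)).1 this.symm
      refine ⟨⟨fun w => autFactor H χ ⟨w - z, sub_mem w⟩ z * c, ?_⟩, ?_⟩
      · intro u w α h
        have e : (⟨w - z, sub_mem w⟩ : Λ) = α + ⟨u - z, sub_mem u⟩ := by
          ext1
          simp only [AddSubgroup.coe_add, h]
          abel
        simp only [e]
        rw [autFactor_add hH hχ]
        simp only [sub_add_cancel]
        ring
      · have e : (⟨z - z, sub_mem ⟨z, hz⟩⟩ : Λ) = 0 := by ext1; simp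
        change autFactor H χ ⟨z - z, sub_mem ⟨z, hz⟩⟩ z * c = c
        rw [e, h0, one_mul]

/-- The holomorphic line bundle `L(H, χ)` over `ℂ² / Λ`. -/
def lineBundle {Λ : AddSubgroup CC} {H : CC → CC → ℂ} (hH : IsRiemannForm Λ H)
    {χ : Λ → Circle} (hχ : IsSemiCharacter Λ H χ) : HolLineBundle Λ where
  Fiber x := autFiber (autFactor H χ) x
  triv x z hz := autTriv hH hχ x z hz
  holomorphic α hα := by
    have key : ∀ z : CC, autTriv hH hχ (z : CC ⧸ Λ) (z + α) (QuotientAddGroup.mk_add_of_mem z hα)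
        ((autTriv hH hχ (z : CC ⧸ Λ) z rfl).symm 1) = autFactor H χ ⟨α, hα⟩ z := by
      intro z
      obtain ⟨f, hf⟩ := (autTriv hH hχ (z : CC ⧸ Λ) z rfl).surjective 1
      rw [← hf, LinearEquiv.symm_apply_apply]
      have h1 : f.1 ⟨z, rfl⟩ = 1 := hf
      have h2 := f.2 ⟨z, rfl⟩ ⟨z + α, QuotientAddGroup.mk_add_of_mem z hα⟩ ⟨α, hα⟩ rfl
      rw [h1, mul_one] at h2
      exact h2
    simp only [key]
    let ℓ : CC →ₗ[ℂ] ℂ :=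
      { toFun := fun z => H z α
        map_add' := fun z w => hH.add_left z w α
        map_smul' := fun c z => hH.smul_left c z α }
    have hℓ : Differentiable ℂ fun z => H z α := (LinearMap.toContinuousLinearMap ℓ).differentiable
    unfold autFactor
    fun_prop

/-! ### Projective embeddings and ampleness -/

/-- The quotient topology on `ℙ^N(ℂ)`. -/
instance projectiveTopology (N : ℕ) : TopologicalSpace (ℙ ℂ (Fin (N + 1) → ℂ)) :=
  TopologicalSpace.coinduced (Projectivization.mk' ℂ) inferInstance

/-- The affine chart `[v] ↦ (v_i / v_j)_i` of `ℙ^N(ℂ)`, with domain `{[v] | v_j ≠ 0}`. (The `j`-th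
entry, constantly equal to `1` on the domain, is kept.) -/
def affineChart {N : ℕ} (j : Fin (N + 1)) (p : ℙ ℂ (Fin (N + 1) → ℂ)) : Fin (N + 1) → ℂ :=
  fun i => p.rep i / p.rep j

/-- `f : ℂ² / Λ → ℙ^N(ℂ)` is an embedding onto a closed complex submanifold: a homeomorphism onto
a closed subset which is holomorphic with injective differential. Holomorphy and differential are
read in the affine charts of the target and in the charts of the source given by the covering
`ℂ² → ℂ² / Λ`. -/
structure IsHolomorphicEmbedding {Λ : AddSubgroup CC} {N : ℕ}
    (f : CC ⧸ Λ → ℙ ℂ (Fin (N + 1) → ℂ)) : Prop where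
  isClosedEmbedding : Topology.IsClosedEmbedding f
  differentiableAt : ∀ (z : CC) (j : Fin (N + 1)), (f z).rep j ≠ 0 →
    DifferentiableAt ℂ (fun w : CC => affineChart j (f w)) z
  injective_fderiv : ∀ (z : CC) (j : Fin (N + 1)), (f z).rep j ≠ 0 →
    Function.Injective (fderiv ℂ (fun w : CC => affineChart j (f w)) z)

namespace HolLineBundle

variable {Λ : AddSubgroup CC}

/-- The global sections of `M` give an embedding of `A` into a projective space: for a basis
`s_0, …, s_N` of `H⁰(A, M)`, the sections have no common zero and `x ↦ [s_0(x) : … : s_N(x)]`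
(computed through any linear identification of the fibre over `x` with `ℂ`) is a holomorphic
embedding. (Another choice of basis changes the map by a projective linear transformation.) -/
def IsVeryAmple (M : HolLineBundle Λ) : Prop :=
  ∃ (N : ℕ) (s : Module.Basis (Fin (N + 1)) ℂ M.sections) (f : CC ⧸ Λ → ℙ ℂ (Fin (N + 1) → ℂ)),
    (∀ (x : CC ⧸ Λ) (e : M.Fiber x ≃ₗ[ℂ] ℂ),
      ∃ h : (fun i => e ((s i : ∀ x, M.Fiber x) x)) ≠ 0, f x = Projectivization.mk ℂ _ h) ∧
    IsHolomorphicEmbedding f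

/-- `M` is ample: some positive tensor power of `M` is very ample. -/
def IsAmple (M : HolLineBundle Λ) : Prop :=
  ∃ n : ℕ, 1 ≤ n ∧ (M.tensorPower n).IsVeryAmple

end HolLineBundle

/-! ### The special objects attached to `τ` -/

/-- `Ω = diag(τ, τ)`. -/
def diagPeriod (τ : ℂ) : Matrix (Fin 2) (Fin 2) ℂ := !![τ, 0; 0, τ]

/-- `H_τ(z, w) = (z₁ w̄₁ + z₂ w̄₂) / Im τ`. -/
def formH (τ : ℂ) (z w : CC) : ℂ :=
  1 / (τ.im : ℂ) * (z 0 * conj (w 0) + z 1 * conj (w 1))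

/-- The vectors `f₁ = (τ, 0)`, `f₂ = (0, τ)`, `f₃ = (1, 0)`, `f₄ = (0, 1)`. -/
def latticeBasis (τ : ℂ) : Fin 4 → CC :=
  ![![τ, 0], ![0, τ], ![1, 0], ![0, 1]]

end

/-! Because the period matrix is diagonal with equal entries, everything reduces to one-variable
theta functions. Pulled back to `ℂ²`, a section of the `n`-th power is an entire function satisfying
the `n`-th power of the canonical functional equation. Dividing by `exp(nπz²/(2 Im τ))` in one
coordinate turns this equation, along lines parallel to that axis, into the classical one, with
multipliers `e(μ)`, `e(ν)` coming from `χ`, where `e(t) = exp(2πit)`. Conversely, products of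
quasi-periodic functions of the two coordinates, times the Gaussians, are theta functions. Upper
bounds on dimension come from Fourier series: the equation for `τ` links coefficients whose indices
differ by `n`, so the one-variable space has dimension at most `n` (`quasiPeriodic_finite`). For `n
= 1`, slicing bounds the two-variable space by `1`, and a product of two translated theta functions
is a nonzero element. For `n ≥ 3`, translates of theta are multiplied as in Lefschetz's theorem.
Only the sum of the translations is prescribed, so two of them, `a` and `b`, stay free. If two
points are not separated, this gives an identity between functions of `a`, `b` and `a + b`;
differentiating with `a + b` fixed shows that `θ(x - ·)/θ(y - ·)` is an exponential, hence `x - y`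
is a period (`exists_int_of_quasiPeriodic_proportional`). If a tangent vector is killed, the same
argument makes `θ'/θ` affine, which is impossible (`eq_zero_of_quasiPeriodic_deriv`). No count of
the zeros of theta is needed. Compactness of the torus and the Hausdorff property of projective
space turn injectivity into a closed embedding. -/

/-! ### Quasi-periodic functions of one variable -/

open Complex in
/-- Entire functions `g` with `g (z + 1) = u g z` and
`g (z + τ) = v exp (-π i n (τ + 2 z)) g z`. -/
def quasiPeriodic (τ u v : ℂ) (n : ℕ) : Submodule ℂ (ℂ → ℂ) where
  carrier := {g | Differentiable ℂ g ∧ (∀ z, g (z + 1) = u * g z) ∧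
    ∀ z, g (z + τ) = v * cexp (-(Real.pi * I * n * (τ + 2 * z))) * g z}
  zero_mem' := ⟨differentiable_const 0, by simp, by simp⟩
  add_mem' := by
    rintro f g ⟨hf, hf1, hf2⟩ ⟨hg, hg1, hg2⟩
    refine ⟨hf.add hg, fun z => ?_, fun z => ?_⟩
    · simp only [Pi.add_apply, hf1, hg1]; ring
    · simp only [Pi.add_apply, hf2, hg2]; ring
  smul_mem' := by
    rintro c f ⟨hf, hf1, hf2⟩
    refine ⟨hf.const_smul c, fun z => ?_, fun z => ?_⟩
    · simp only [Pi.smul_apply, smul_eq_mul, hf1]; ring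
    · simp only [Pi.smul_apply, smul_eq_mul, hf2]; ring

/-! ### Fourier coefficients and the dimension of the one-variable spaces. -/

section Fourier

open Complex MeasureTheory intervalIntegral

/-- The mean of a `1`-periodic entire function over a horizontal unit segment does not depend on
the segment. -/
theorem integral_add_const_of_periodic {p : ℂ → ℂ} (hp : Differentiable ℂ p)
    (h1 : ∀ z, p (z + 1) = p z) (w : ℂ) :
    ∫ x in (0 : ℝ)..1, p (x + w) = ∫ x in (0 : ℝ)..1, p x := by
  -- The radius leaves room for the unit segment from `w` and for the unit translate of the ball of
  -- radius `‖w‖ + 1`. A primitive `q` of `p` exists on the large ball, and each mean is a value of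
  -- `q(z + 1) - q(z)`, whose derivative vanishes by periodicity.
  set R : ℝ := ‖w‖ + 3
  obtain ⟨q, hq⟩ := (hp.differentiableOn (s := Metric.ball 0 R)).isExactOn_ball
  have hR : ∀ z : ℂ, ‖z‖ < R → HasDerivAt q (p z) z := fun z hz => hq z (by simpa using hz)
  have key : ∀ w' : ℂ, ‖w'‖ ≤ ‖w‖ → ∫ x in (0 : ℝ)..1, p (x + w') = q (w' + 1) - q w' := by
    intro w' hw'
    have : ∀ x ∈ Set.uIcc (0 : ℝ) 1, HasDerivAt (fun x : ℝ => q (x + w')) (p (x + w')) x := by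
      intro x hx
      rw [Set.uIcc_of_le zero_le_one] at hx
      have h2 : ‖(x : ℂ) + w'‖ < R := by
        have := norm_add_le (x : ℂ) w'
        rw [Complex.norm_real, Real.norm_of_nonneg hx.1] at this
        have := hx.2
        simp only [R]; linarith
      exact ((hR _ h2).comp_add_const (x : ℂ) w').comp_ofReal
    rw [integral_eq_sub_of_hasDerivAt this]
    · simp [add_comm]
    · apply Continuous.intervalIntegrable
      exact hp.continuous.comp (by fun_prop)
  have hd : ∀ z ∈ Metric.ball (0 : ℂ) (‖w‖ + 1),
      HasDerivAt (fun z => q (z + 1) - q z) (p (z + 1) - p z) z := by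
    intro z hz
    rw [mem_ball_zero_iff] at hz
    have h2 : ‖z + 1‖ < R := by
      have := norm_add_le z 1
      rw [norm_one] at this
      simp only [R]; linarith
    exact ((hR _ h2).comp_add_const z 1).sub (hR z (by simp only [R]; linarith))
  have hc := Metric.isOpen_ball.is_const_of_deriv_eq_zero
    (convex_ball (0 : ℂ) (‖w‖ + 1)).isPreconnected
    (fun z hz => (hd z hz).differentiableAt.differentiableWithinAt)
    (fun z hz => by rw [(hd z hz).deriv, h1, sub_self]; rfl)
    (x := w) (y := 0) (by simp) (by simp; positivity)
  have h0 := key 0 (by simp)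
  simp only [add_zero] at h0
  rw [key w le_rfl, h0]
  simpa using hc

/-- A continuous `1`-periodic function all of whose Fourier coefficients vanish is zero. -/
theorem eq_zero_of_forall_integral_eq_zero {f : ℝ → ℂ} (hf : Continuous f)
    (h1 : ∀ x, f (x + 1) = f x)
    (h : ∀ k : ℤ, ∫ x in (0 : ℝ)..1, cexp (-(2 * Real.pi * I * k * x)) * f x = 0) (x : ℝ) :
    f x = 0 := by
  have : Fact ((0 : ℝ) < 1) := ⟨one_pos⟩
  let F : C(AddCircle (1 : ℝ), ℂ) := ⟨Function.Periodic.lift (f := f) (c := 1) h1,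
    continuous_coinduced_dom.2 hf⟩
  have hF : ∀ x : ℝ, F x = f x := fun x => rfl
  have hz : ∀ k, fourierCoeff F k = 0 := by
    intro k
    rw [fourierCoeff_eq_intervalIntegral F k 0]
    simp only [zero_add, hF, fourier_coe_apply, smul_eq_mul]
    rw [div_one, one_smul, ← h k]
    apply integral_congr
    intro x _
    simp only
    congr 2
    push_cast
    ring
  have hs := has_pointwise_sum_fourier_series_of_summable (f := F) (by
    rw [show fourierCoeff F = fun _ => 0 from funext hz]; exact summable_zero) x
  simp only [hz, zero_smul] at hs
  rw [← hF]
  exact hs.unique hasSum_zero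

/-- The `k`-th Fourier coefficient of an entire function `g` with `g (z + 1) = e(μ) g z`. -/
noncomputable def twistedCoeff (μ : ℂ) (k : ℤ) (g : ℂ → ℂ) : ℂ :=
  ∫ x in (0 : ℝ)..1, cexp (-(2 * Real.pi * I * (k + μ) * x)) * g x

variable {τ μ v : ℂ} {n : ℕ}

/-- The integrand is `1`-periodic, so the segment can be moved by `τ`; the functional equation then
contributes a factor `e(-nx)`, which raises the index by `n`. -/
theorem twistedCoeff_shift {g : ℂ → ℂ}
    (hg : g ∈ quasiPeriodic τ (cexp (2 * Real.pi * I * μ)) v n) (k : ℤ) :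
    twistedCoeff μ k g = v * cexp (-(Real.pi * I * n * τ) - 2 * Real.pi * I * (k + μ) * τ) *
      twistedCoeff μ (k + n) g := by
  obtain ⟨hd, hp, hq⟩ := hg
  have h := integral_add_const_of_periodic
    (p := fun z => cexp (-(2 * Real.pi * I * (k + μ) * z)) * g z) (by fun_prop) (fun z => by
      have h1 := Complex.exp_int_mul_two_pi_mul_I (-k)
      rw [hp, ← mul_assoc, ← Complex.exp_add, show -(2 * Real.pi * I * (k + μ) * (z + 1)) +
        2 * Real.pi * I * μ = -(2 * Real.pi * I * (k + μ) * z) + (-k : ℤ) * (2 * Real.pi * I) by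
          push_cast; ring, Complex.exp_add, h1, mul_one]) τ
  unfold twistedCoeff
  rw [← h, ← intervalIntegral.integral_const_mul]
  apply integral_congr
  intro x _
  simp only
  rw [hq]
  rw [show -(2 * Real.pi * I * (k + μ) * ((x : ℂ) + τ)) = (-(2 * Real.pi * I * (k + μ) * τ)) +
    (-(2 * Real.pi * I * (k + μ) * x)) by ring, Complex.exp_add,
    show -(Real.pi * I * n * (τ + 2 * x)) = (-(Real.pi * I * n * τ)) + (-(2 * Real.pi * I * n * x))
    by ring, Complex.exp_add, sub_eq_add_neg, Complex.exp_add,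
    show -(2 * Real.pi * I * (((k + n : ℤ) : ℂ) + μ) * x) =
      (-(2 * Real.pi * I * (k + μ) * x)) + (-(2 * Real.pi * I * n * x)) by push_cast; ring,
    Complex.exp_add]
  ring

/-- The shift relation has nonzero factors, so vanishing spreads from one representative of each
class modulo `n` to all indices. Then `g` is zero on the real line, hence everywhere by the identity
theorem. -/
theorem eq_zero_of_twistedCoeff_eq_zero (hv : v ≠ 0) (hn : 0 < n) {g : ℂ → ℂ}
    (hg : g ∈ quasiPeriodic τ (cexp (2 * Real.pi * I * μ)) v n)
    (h : ∀ j : Fin n, twistedCoeff μ (j : ℕ) g = 0) : g = 0 := by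
  have step : ∀ k : ℤ, twistedCoeff μ k g = 0 ↔ twistedCoeff μ (k + n) g = 0 := by
    intro k
    rw [twistedCoeff_shift hg k]
    simp [hv, Complex.exp_ne_zero]
  have steps : ∀ q k : ℤ, twistedCoeff μ k g = 0 ↔ twistedCoeff μ (k + n * q) g = 0 := by
    intro q
    induction q using Int.induction_on with
    | zero => simp
    | succ i ih =>
      intro k
      rw [ih k, step, mul_add, mul_one, add_assoc]
    | pred i ih =>
      intro k
      rw [ih k, step (k + n * (-i - 1))]
      congr! 2
      ring
  have hall : ∀ k : ℤ, twistedCoeff μ k g = 0 := by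
    intro k
    have hn' : (n : ℤ) ≠ 0 := by exact_mod_cast hn.ne'
    have h0 := Int.emod_nonneg k hn'
    have h1 := Int.emod_lt_of_pos k (by exact_mod_cast hn : (0 : ℤ) < n)
    have := h ⟨(k % n).toNat, by omega⟩
    simp only [Int.toNat_of_nonneg h0] at this
    rw [← Int.emod_add_mul_ediv k n, ← steps]
    exact this
  obtain ⟨hd, hp, -⟩ := hg
  have hreal : ∀ x : ℝ, g x = 0 := by
    intro x
    have := eq_zero_of_forall_integral_eq_zero
      (f := fun x : ℝ => cexp (-(2 * Real.pi * I * μ * x)) * g x)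
      ((by fun_prop : Continuous fun x : ℝ => cexp (-(2 * Real.pi * I * μ * x))).mul
        (hd.continuous.comp Complex.continuous_ofReal)) (fun x => by
        push_cast
        rw [hp, ← mul_assoc, ← Complex.exp_add]
        congr 2
        ring) (fun k => by
        rw [← hall k]
        apply integral_congr
        intro x _
        simp only
        rw [← mul_assoc, ← Complex.exp_add]
        congr 2
        ring) x
    simpa [Complex.exp_ne_zero] using this
  have hA : AnalyticOnNhd ℂ g Set.univ := fun z _ => hd.analyticAt z
  funext z
  refine hA.eqOn_zero_of_preconnected_of_frequently_eq_zero isPreconnected_univ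
    (Set.mem_univ (0 : ℂ)) ?_ (Set.mem_univ z)
  have ht : Filter.Tendsto (fun x : ℝ => (x : ℂ)) (nhdsWithin 0 {0}ᶜ) (nhdsWithin 0 {0}ᶜ) := by
    apply Filter.Tendsto.inf
    · simpa using (Complex.continuous_ofReal.tendsto 0)
    · simp
  exact ht.frequently (Filter.Eventually.of_forall hreal).frequently

/-- The coefficients of index `0, …, n - 1` embed the space into `ℂⁿ`. The upper bound suffices:
nonzero elements are supplied by explicit products of theta functions. -/
theorem quasiPeriodic_finite (hv : v ≠ 0) (hn : 0 < n) :
    FiniteDimensional ℂ (quasiPeriodic τ (cexp (2 * Real.pi * I * μ)) v n) ∧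
      Module.finrank ℂ (quasiPeriodic τ (cexp (2 * Real.pi * I * μ)) v n) ≤ n := by
  let L : quasiPeriodic τ (cexp (2 * Real.pi * I * μ)) v n →ₗ[ℂ] (Fin n → ℂ) :=
    { toFun := fun g j => twistedCoeff μ (j : ℕ) g
      map_add' := by
        intro f g
        ext j
        simp only [twistedCoeff, Submodule.coe_add, Pi.add_apply, mul_add]
        apply intervalIntegral.integral_add <;> apply Continuous.intervalIntegrable
        · exact (by fun_prop : Continuous _).mul (f.2.1.continuous.comp Complex.continuous_ofReal)
        · exact (by fun_prop : Continuous _).mul (g.2.1.continuous.comp Complex.continuous_ofReal)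
      map_smul' := by
        intro c f
        ext j
        simp only [twistedCoeff, Submodule.coe_smul, Pi.smul_apply, smul_eq_mul,
          RingHom.id_apply]
        rw [← intervalIntegral.integral_const_mul]
        apply integral_congr
        intro x _
        simp only
        ring }
  have hL : Function.Injective L := by
    rw [← LinearMap.ker_eq_bot, LinearMap.ker_eq_bot']
    intro g hg
    exact Subtype.ext (eq_zero_of_twistedCoeff_eq_zero hv hn g.2 (fun j => congrFun hg j))
  refine ⟨FiniteDimensional.of_injective L hL, ?_⟩
  simpa using LinearMap.finrank_le_finrank_of_injective hL

/-- `jacobiTheta₂ · τ` does not vanish identically: its zeroth Fourier coefficient is `1`. -/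
theorem exists_jacobiTheta₂_ne_zero (hτ : 0 < τ.im) : ∃ z, jacobiTheta₂ z τ ≠ 0 := by
  by_contra! hcon
  have hs := intervalIntegral.hasSum_intervalIntegral_of_summable_norm (a := 0) (b := 1) (ι := ℤ)
    (f := fun k => ⟨fun x : ℝ => jacobiTheta₂_term k x τ, by
      unfold jacobiTheta₂_term; fun_prop⟩) ((by
      -- The first `0` bounds the imaginary part of the real argument; the last is the exponent of
      -- the polynomial factor, which is not wanted here.
      refine ((summable_pow_mul_jacobiTheta₂_term_bound 0 hτ 0).of_nonneg_of_le
        (fun _ => norm_nonneg _) fun k => ?_)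
      refine (ContinuousMap.norm_le _ (by positivity)).2 fun x => ?_
      simpa using norm_jacobiTheta₂_term_le (S := 0) hτ (z := x) (by simp) le_rfl k))
  have h0 : ∀ x : ℝ, ∑' k : ℤ, jacobiTheta₂_term k x τ = 0 := fun x => hcon x
  simp only [ContinuousMap.coe_mk, h0] at hs
  have h1 : ∀ k : ℤ, k ≠ 0 → ∫ x in (0 : ℝ)..1, jacobiTheta₂_term k x τ = 0 := by
    intro k hk
    have hk' : (2 * Real.pi * I * k : ℂ) ≠ 0 := by
      have := Complex.two_pi_I_ne_zero
      have : (k : ℂ) ≠ 0 := by exact_mod_cast hk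
      positivity
    simp only [jacobiTheta₂_term, Complex.exp_add]
    rw [intervalIntegral.integral_mul_const, integral_exp_mul_complex hk']
    have : cexp (2 * Real.pi * I * k * (1 : ℝ)) = 1 := by
      rw [← Complex.exp_int_mul_two_pi_mul_I k]; congr 1; push_cast; ring
    rw [this]
    simp
  -- Termwise integration leaves only the term `k = 0`, equal to `1`, whereas the integral of the
  -- sum is `0`.
  have h2 := hs.unique (hasSum_single 0 h1)
  simp [jacobiTheta₂_term] at h2

end Fourier

/-! ### Functional equations in `a`, `b` and `a + b`, solved by Wronskians. -/

section Wronskian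

open Complex

theorem forall_eq_zero_of_mul_eq_zero {f g : ℂ → ℂ} (hf : Differentiable ℂ f)
    (hg : Differentiable ℂ g) (h : ∀ z, f z * g z = 0) (hne : ∃ z, f z ≠ 0) (z : ℂ) : g z = 0 := by
  have := AnalyticOnNhd.eq_zero_or_eq_zero_of_mul_eq_zero (𝕜 := ℂ) (U := Set.univ)
    (fun z _ => hf.analyticAt z) (fun z _ => hg.analyticAt z) (fun z _ => h z) isPreconnected_univ
  obtain ⟨w, hw⟩ := hne
  rcases this with h1 | h1
  · exact absurd (h1 w (Set.mem_univ w)) hw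
  · exact h1 z (Set.mem_univ z)

theorem exists_ne_zero_and_ne_zero {f g : ℂ → ℂ} (hf : Differentiable ℂ f)
    (hg : Differentiable ℂ g) (hf0 : ∃ z, f z ≠ 0) (hg0 : ∃ z, g z ≠ 0) :
    ∃ z, f z ≠ 0 ∧ g z ≠ 0 := by
  by_contra! hcon
  obtain ⟨w, hw⟩ := hg0
  refine hw (forall_eq_zero_of_mul_eq_zero hf hg (fun z => ?_) hf0 w)
  by_cases h : f z = 0
  · rw [h, zero_mul]
  · rw [hcon z h, mul_zero]

/-- Two entire functions with vanishing Wronskian are proportional. -/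
theorem exists_eq_mul_of_wronskian_eq_zero {f g : ℂ → ℂ} (hf : Differentiable ℂ f)
    (hg : Differentiable ℂ g) (hg0 : ∃ z, g z ≠ 0)
    (h : ∀ z, deriv f z * g z - f z * deriv g z = 0) : ∃ c : ℂ, ∀ z, f z = c * g z := by
  obtain ⟨w, hw⟩ := hg0
  have hopen : IsOpen {z | g z ≠ 0} := isOpen_ne_fun hg.continuous continuous_const
  obtain ⟨r, hr, hball⟩ := Metric.isOpen_iff.1 hopen w hw
  -- The quotient is formed only on a ball where `g` has no zero; the identity theorem then extends
  -- the proportionality.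
  have hd : ∀ z ∈ Metric.ball w r, HasDerivAt (fun z => f z / g z) 0 z := by
    intro z hz
    have := (hf z).hasDerivAt.div (hg z).hasDerivAt (hball hz)
    rwa [h z, zero_div] at this
  have hc : ∀ y ∈ Metric.ball w r, f y / g y = f w / g w := fun y hy =>
    Metric.isOpen_ball.is_const_of_deriv_eq_zero (convex_ball w r).isPreconnected
      (fun z hz => (hd z hz).differentiableAt.differentiableWithinAt)
      (fun z hz => (hd z hz).deriv) hy (Metric.mem_ball_self hr)
  refine ⟨f w / g w, fun z => ?_⟩
  have hA : AnalyticOnNhd ℂ f Set.univ := fun z _ => hf.analyticAt z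
  have hB : AnalyticOnNhd ℂ (fun z => f w / g w * g z) Set.univ :=
    fun z _ => (hg.const_mul _).analyticAt z
  refine hA.eqOn_of_preconnected_of_eventuallyEq hB isPreconnected_univ (Set.mem_univ w) ?_
    (Set.mem_univ z)
  filter_upwards [Metric.ball_mem_nhds w hr] with y hy
  have h1 := hc y hy
  have h2 : g y ≠ 0 := hball hy
  rw [← h1, div_mul_cancel₀ _ h2]

/-- Along `(a + t, b - t)` the sum `a + b` is fixed, so factors depending on it act as constants
under differentiation. -/
theorem hasDerivAt_add_mul_sub {f g : ℂ → ℂ} (hf : Differentiable ℂ f) (hg : Differentiable ℂ g)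
    (a b : ℂ) : HasDerivAt (fun t => f (a + t) * g (b - t))
      (deriv f a * g b - f a * deriv g b) 0 := by
  have h1 : HasDerivAt (fun t => f (a + t)) (deriv f a) 0 := by
    have := (hf (a + 0)).hasDerivAt.comp_const_add a 0
    rwa [add_zero] at this
  have h2 : HasDerivAt (fun t => g (b - t)) (-deriv g b) 0 := by
    have := (hg (b - 0)).hasDerivAt.comp_const_sub b 0
    rwa [sub_zero] at this
  refine (h1.mul h2).congr_deriv ?_
  rw [add_zero, sub_zero]
  ring

/-- If `p a * p b * r (a + b)` and `q a * q b * s (a + b)` are proportional, then `p / q` is an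
exponential function. -/
theorem exists_eq_exp_mul_of_mul_mul {p q r s : ℂ → ℂ} (hp : Differentiable ℂ p)
    (hq : Differentiable ℂ q) (hr : Differentiable ℂ r) (hs : Differentiable ℂ s)
    (hp0 : ∃ z, p z ≠ 0) (hq0 : ∃ z, q z ≠ 0) (hr0 : ∃ z, r z ≠ 0) (hs0 : ∃ z, s z ≠ 0)
    {c : ℂ} (hc : c ≠ 0)
    (h : ∀ a b, p a * p b * r (a + b) = c * (q a * q b * s (a + b))) :
    ∃ k l : ℂ, ∀ z, p z = l * cexp (k * z) * q z := by
  have hD : ∀ a b, (deriv p a * p b - p a * deriv p b) * r (a + b) =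
      c * ((deriv q a * q b - q a * deriv q b) * s (a + b)) := by
    intro a b
    have h1 := (hasDerivAt_add_mul_sub hp hp a b).mul_const (r (a + b))
    have h2 := ((hasDerivAt_add_mul_sub hq hq a b).mul_const (s (a + b))).const_mul c
    refine h1.unique (h2.congr_of_eventuallyEq (Filter.Eventually.of_forall fun t => ?_))
    have := h (a + t) (b - t)
    rwa [show a + t + (b - t) = a + b by ring] at this
  obtain ⟨b, hpb, hqb⟩ := exists_ne_zero_and_ne_zero hp hq hp0 hq0
  have hr' : Differentiable ℂ fun a => r (a + b) := by fun_prop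
  have hs' : Differentiable ℂ fun a => s (a + b) := by fun_prop
  -- Comparing `hD` with `h` eliminates `r` and `s`. What remains says that `p'/p - q'/q` takes the
  -- same value at `a` and at `b`; this value is `k` below.
  have key : ∀ a, (deriv p a * p b - p a * deriv p b) * (q a * q b) -
      (deriv q a * q b - q a * deriv q b) * (p a * p b) = 0 := by
    refine forall_eq_zero_of_mul_eq_zero (f := fun a => r (a + b) * s (a + b)) (hr'.mul hs')
      ?_ ?_ ?_
    · have := hp.deriv
      have := hq.deriv
      fun_prop
    · intro a
      apply mul_left_cancel₀ hc
      linear_combination c * s (a + b) * (q a * q b) * hD a b -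
        c * s (a + b) * (deriv q a * q b - q a * deriv q b) * h a b
    · obtain ⟨z, h1, h2⟩ := exists_ne_zero_and_ne_zero hr' hs'
        (let ⟨z, hz⟩ := hr0; ⟨z - b, by simpa using hz⟩)
        (let ⟨z, hz⟩ := hs0; ⟨z - b, by simpa using hz⟩)
      exact ⟨z, mul_ne_zero h1 h2⟩
  set k := deriv p b / p b - deriv q b / q b with hk
  have key2 : ∀ a, deriv p a * q a - p a * deriv q a = k * (p a * q a) := by
    intro a
    have := key a
    rw [hk]
    field_simp
    linear_combination this
  obtain ⟨l, hl⟩ := exists_eq_mul_of_wronskian_eq_zero (f := fun z => p z * cexp (-(k * z)))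
    (g := q) (by fun_prop) hq hq0 (by
      intro z
      have h1 : HasDerivAt (fun z => cexp (-(k * z))) (cexp (-(k * z)) * -(k * 1)) z :=
        (((hasDerivAt_id z).const_mul k).neg).cexp
      have h2 := ((hp z).hasDerivAt.mul h1).deriv
      change deriv (fun z => p z * cexp (-(k * z))) z = _ at h2
      rw [h2]
      linear_combination cexp (-(k * z)) * key2 z)
  refine ⟨k, l, fun z => ?_⟩
  have := hl z
  have h3 : cexp (-(k * z)) * cexp (k * z) = 1 := by rw [← Complex.exp_add]; simp
  linear_combination cexp (k * z) * this - p z * h3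

/-- If the sum of `q / p` at `a`, of `q / p` at `b` and of `s / r` at `a + b` is constant, then
`q / p` is an affine function. -/
theorem exists_eq_affine_mul_of_add {p q r s : ℂ → ℂ} (hp : Differentiable ℂ p)
    (hq : Differentiable ℂ q) (hr : Differentiable ℂ r)
    (hp0 : ∃ z, p z ≠ 0) (hr0 : ∃ z, r z ≠ 0) {c : ℂ}
    (h : ∀ a b, (q a * p b + p a * q b) * r (a + b) + p a * p b * s (a + b) =
      c * (p a * p b * r (a + b))) :
    ∃ k l : ℂ, ∀ z, q z = (k * z + l) * p z := by
  have hD : ∀ a b, ((deriv q a * p b - q a * deriv p b) + (deriv p a * q b - p a * deriv q b)) *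
      r (a + b) + (deriv p a * p b - p a * deriv p b) * s (a + b) =
      c * ((deriv p a * p b - p a * deriv p b) * r (a + b)) := by
    intro a b
    have h1 := (((hasDerivAt_add_mul_sub hq hp a b).add
      (hasDerivAt_add_mul_sub hp hq a b)).mul_const (r (a + b))).add
      ((hasDerivAt_add_mul_sub hp hp a b).mul_const (s (a + b)))
    have h2 := ((hasDerivAt_add_mul_sub hp hp a b).mul_const (r (a + b))).const_mul c
    refine h1.unique (h2.congr_of_eventuallyEq (Filter.Eventually.of_forall fun t => ?_))
    have := h (a + t) (b - t)
    rwa [show a + t + (b - t) = a + b by ring] at this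
  obtain ⟨b, hpb⟩ := hp0
  have hr' : Differentiable ℂ fun a => r (a + b) := by fun_prop
  -- Eliminating `s` and `c` between `hD` and `h` leaves a multiple of `r`. After cancelling `r`,
  -- the derivative of `q / p` is the same at `a` and `b`, and `k` is that constant.
  have key : ∀ a, p b ^ 2 * (deriv q a * p a - deriv p a * q a) -
      p a ^ 2 * (deriv q b * p b - deriv p b * q b) = 0 := by
    refine forall_eq_zero_of_mul_eq_zero hr' ?_ ?_ ?_
    · have := hp.deriv
      have := hq.deriv
      fun_prop
    · intro a
      linear_combination p a * p b * hD a b - (deriv p a * p b - p a * deriv p b) * h a b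
    · obtain ⟨z, hz⟩ := hr0
      exact ⟨z - b, by simpa using hz⟩
  set k := (deriv q b * p b - deriv p b * q b) / p b ^ 2 with hk
  have key2 : ∀ a, deriv q a * p a - deriv p a * q a = k * p a ^ 2 := by
    intro a
    have := key a
    rw [hk]
    field_simp
    linear_combination this
  obtain ⟨l, hl⟩ := exists_eq_mul_of_wronskian_eq_zero (f := fun z => q z - k * z * p z)
    (g := p) (by fun_prop) hp ⟨b, hpb⟩ (by
      intro z
      have h2 := ((hq z).hasDerivAt.sub (((hasDerivAt_id z).const_mul k).mul
        (hp z).hasDerivAt)).deriv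
      change deriv (fun z => q z - k * z * p z) z = _ at h2
      rw [h2]
      simp only [id]
      linear_combination key2 z)
  exact ⟨k, l, fun z => by linear_combination hl z⟩

end Wronskian

/-! ### Rigidity of the Jacobi theta function. -/

section Theta

open Complex

variable {τ : ℂ}

theorem differentiable_jacobiTheta₂_left (hτ : 0 < τ.im) :
    Differentiable ℂ fun z => jacobiTheta₂ z τ :=
  fun z => differentiableAt_jacobiTheta₂_fst z hτ

theorem differentiable_jacobiTheta₂'_left (hτ : 0 < τ.im) :
    Differentiable ℂ fun z => jacobiTheta₂' z τ := by
  have : deriv (fun z => jacobiTheta₂ z τ) = fun z => jacobiTheta₂' z τ :=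
    funext fun z => (hasDerivAt_jacobiTheta₂_fst z hτ).deriv
  rw [← this]
  exact (differentiable_jacobiTheta₂_left hτ).deriv

theorem exists_jacobiTheta₂_add_ne_zero (hτ : 0 < τ.im) (x : ℂ) :
    ∃ z, jacobiTheta₂ (x + z) τ ≠ 0 := by
  obtain ⟨z, hz⟩ := exists_jacobiTheta₂_ne_zero hτ
  exact ⟨z - x, by simpa using hz⟩

theorem exists_jacobiTheta₂_sub_ne_zero (hτ : 0 < τ.im) (x : ℂ) :
    ∃ z, jacobiTheta₂ (x - z) τ ≠ 0 := by
  obtain ⟨z, hz⟩ := exists_jacobiTheta₂_ne_zero hτ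
  exact ⟨x - z, by simpa using hz⟩

theorem jacobiTheta₂_sub_add_left (z a : ℂ) :
    jacobiTheta₂ (z + τ - a) τ =
      cexp (-(Real.pi * I * (τ + 2 * z)) + 2 * Real.pi * I * a) * jacobiTheta₂ (z - a) τ := by
  rw [show z + τ - a = (z - a) + τ by ring, jacobiTheta₂_add_left']
  congr 2
  ring

/-- If translating the theta function by `t` multiplies it by an exponential function, then `t` is
a lattice point. -/
theorem exists_int_of_jacobiTheta₂_add_eq (hτ : 0 < τ.im) {t k l : ℂ}
    (h : ∀ z, jacobiTheta₂ (z + t) τ = l * cexp (k * z) * jacobiTheta₂ z τ) :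
    ∃ m n : ℤ, t = m * τ + n := by
  obtain ⟨z, hz⟩ := exists_jacobiTheta₂_ne_zero hτ
  have hl : l ≠ 0 := by
    rintro rfl
    have := h (z - t)
    simp [hz] at this
  have hz' : l * cexp (k * z) * jacobiTheta₂ z τ ≠ 0 :=
    mul_ne_zero (mul_ne_zero hl (Complex.exp_ne_zero _)) hz
  -- The period `1` forces `exp k = 1`, and the period `τ` forces `e(-t) = exp(kτ)`. Taking
  -- logarithms expresses `t` through the periods.
  have h1 := h (z + 1)
  rw [show z + 1 + t = z + t + 1 by ring, jacobiTheta₂_add_left, jacobiTheta₂_add_left, h z,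
    mul_add, Complex.exp_add, mul_one] at h1
  have h2 : cexp k = 1 := mul_left_cancel₀ hz' (by linear_combination -h1)
  have h3 := h (z + τ)
  rw [show z + τ + t = z + t + τ by ring, jacobiTheta₂_add_left', jacobiTheta₂_add_left', h z,
    mul_add k, Complex.exp_add, show -Real.pi * I * (τ + 2 * (z + t)) = -Real.pi * I * (τ + 2 * z)
    + -(2 * Real.pi * I * t) by ring, Complex.exp_add] at h3
  have h4 : cexp (-(2 * Real.pi * I * t)) = cexp (k * τ) :=
    mul_left_cancel₀ (mul_ne_zero (Complex.exp_ne_zero (-Real.pi * I * (τ + 2 * z))) hz')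
      (by linear_combination h3)
  obtain ⟨m, hm⟩ := Complex.exp_eq_one_iff.1 h2
  obtain ⟨n, hn⟩ := Complex.exp_eq_exp_iff_exists_int.1 h4
  refine ⟨-m, -n, ?_⟩
  apply mul_left_cancel₀ Complex.two_pi_I_ne_zero
  push_cast
  rw [hm] at hn
  linear_combination -hn

/-- The logarithmic derivative of the theta function is not affine. -/
theorem jacobiTheta₂'_ne_affine_mul (hτ : 0 < τ.im) {k l : ℂ}
    (h : ∀ z, jacobiTheta₂' z τ = (k * z + l) * jacobiTheta₂ z τ) : False := by
  obtain ⟨z, hz⟩ := exists_jacobiTheta₂_ne_zero hτ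
  -- The logarithmic derivative is unchanged by the period `1`, so `k = 0`; but the period `τ`
  -- lowers it by `2πi`, so it is not constant either.
  have h1 := h (z + 1)
  rw [jacobiTheta₂_add_left, jacobiTheta₂'_add_left, h z] at h1
  have hk : k = 0 := mul_right_cancel₀ hz (by linear_combination -h1)
  have h2 := h (z + τ)
  rw [jacobiTheta₂_add_left', jacobiTheta₂'_add_left', h z, hk] at h2
  have h3 : (2 * Real.pi * I : ℂ) = 0 :=
    mul_left_cancel₀ (mul_ne_zero (Complex.exp_ne_zero (-Real.pi * I * (τ + 2 * z))) hz)
      (by linear_combination -h2)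
  exact Complex.two_pi_I_ne_zero h3

end Theta

/-! ### Products of translated theta functions, separating points and tangent vectors. -/

section ThetaProduct

open Complex

variable {τ : ℂ}

/-- A product of `m + 3` translates of the theta function, the sum of the translations being
`s`. -/
noncomputable def thetaProduct (τ μ s e : ℂ) (m : ℕ) (a b z : ℂ) : ℂ :=
  cexp (2 * Real.pi * I * μ * z) * jacobiTheta₂ (z - e) τ ^ m *
    (jacobiTheta₂ (z - a) τ * jacobiTheta₂ (z - b) τ *
      jacobiTheta₂ (z - (s - m * e) + (a + b)) τ)

/-- Translating theta by `c` contributes `e(c)` to the multiplier at `τ`, so only the sum of the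
translations matters. The exponential factor already contributes `e(μτ)`, so the sum must be `ν -
μτ`, with `a` and `b` free. -/
theorem thetaProduct_mem (hτ : 0 < τ.im) (μ ν e : ℂ) (m : ℕ) (a b : ℂ) :
    thetaProduct τ μ (ν - μ * τ) e m a b ∈ quasiPeriodic τ (cexp (2 * Real.pi * I * μ))
      (cexp (2 * Real.pi * I * ν)) (m + 3) := by
  have hd := differentiable_jacobiTheta₂_left hτ
  have hd' : ∀ c : ℂ, Differentiable ℂ fun z => jacobiTheta₂ (z - c) τ :=
    fun c => hd.comp (differentiable_id.sub_const c)
  have hd'' : ∀ c d : ℂ, Differentiable ℂ fun z => jacobiTheta₂ (z - c + d) τ :=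
    fun c d => hd.comp ((differentiable_id.sub_const c).add_const d)
  refine ⟨?_, fun z => ?_, fun z => ?_⟩
  · unfold thetaProduct
    exact (Differentiable.mul (by fun_prop) ((hd' e).pow m)).mul
      (((hd' a).mul (hd' b)).mul (hd'' _ _))
  · have h : ∀ c : ℂ, jacobiTheta₂ (z + 1 - c) τ = jacobiTheta₂ (z - c) τ := fun c => by
      rw [show z + 1 - c = z - c + 1 by ring, jacobiTheta₂_add_left]
    have h' : ∀ c d : ℂ, jacobiTheta₂ (z + 1 - c + d) τ = jacobiTheta₂ (z - c + d) τ := fun c d => by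
      rw [show z + 1 - c + d = z - c + d + 1 by ring, jacobiTheta₂_add_left]
    simp only [thetaProduct, h, h', mul_add, mul_one, Complex.exp_add]
    ring
  · simp only [thetaProduct]
    rw [show z + τ - (ν - μ * τ - m * e) + (a + b) = z + τ - (ν - μ * τ - m * e - (a + b)) by ring,
      show z - (ν - μ * τ - m * e) + (a + b) = z - (ν - μ * τ - m * e - (a + b)) by ring]
    simp only [jacobiTheta₂_sub_add_left, mul_pow, ← Complex.exp_nat_mul]
    set A := jacobiTheta₂ (z - a) τ
    set B := jacobiTheta₂ (z - b) τ
    set D := jacobiTheta₂ (z - (ν - μ * τ - m * e - (a + b))) τ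
    set F := jacobiTheta₂ (z - e) τ
    have key : cexp (2 * Real.pi * I * μ * (z + τ)) *
        cexp (m * (-(Real.pi * I * (τ + 2 * z)) + 2 * Real.pi * I * e)) *
        (cexp (-(Real.pi * I * (τ + 2 * z)) + 2 * Real.pi * I * a) *
        cexp (-(Real.pi * I * (τ + 2 * z)) + 2 * Real.pi * I * b) *
        cexp (-(Real.pi * I * (τ + 2 * z)) +
          2 * Real.pi * I * (ν - μ * τ - m * e - (a + b)))) =
        cexp (2 * Real.pi * I * ν) * cexp (-(Real.pi * I * ((m + 3 : ℕ) : ℂ) * (τ + 2 * z))) *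
          cexp (2 * Real.pi * I * μ * z) := by
      simp only [← Complex.exp_add]
      congr 1
      push_cast
      ring
    linear_combination F ^ m * (A * B * D) * key

variable {μ ν : ℂ} {n : ℕ}

theorem exists_quasiPeriodic_ne_zero (hτ : 0 < τ.im) (hn : 3 ≤ n) (x : ℂ) :
    ∃ g ∈ quasiPeriodic τ (cexp (2 * Real.pi * I * μ)) (cexp (2 * Real.pi * I * ν)) n,
      g x ≠ 0 := by
  obtain ⟨m, rfl⟩ := Nat.exists_eq_add_of_le' hn
  have hd := differentiable_jacobiTheta₂_left hτ
  obtain ⟨e, he⟩ := exists_jacobiTheta₂_sub_ne_zero hτ x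
  -- With `a = e`, it remains to choose `b` off the zeros of two nonzero entire functions.
  obtain ⟨b, hb, hb'⟩ := exists_ne_zero_and_ne_zero
    (f := fun b => jacobiTheta₂ (x - b) τ)
    (g := fun b => jacobiTheta₂ (x - (ν - μ * τ - m * e) + (e + b)) τ)
    (hd.comp (by fun_prop)) (hd.comp (by fun_prop)) ⟨e, he⟩ (by
      obtain ⟨z, hz⟩ := exists_jacobiTheta₂_add_ne_zero hτ (x - (ν - μ * τ - m * e) + e)
      exact ⟨z, by rwa [← add_assoc]⟩)
  refine ⟨_, thetaProduct_mem hτ μ ν e m e b, ?_⟩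
  exact mul_ne_zero (mul_ne_zero (Complex.exp_ne_zero _) (pow_ne_zero _ he))
    (mul_ne_zero (mul_ne_zero he hb) hb')

/-- Applied to all theta products, the hypothesis is the multiplicative functional equation in `a`,
`b` with `p = θ(x - ·)` and `q = θ(y - ·)`. The parameter `e` keeps the fixed factors nonzero at
both points. -/
theorem exists_int_of_quasiPeriodic_proportional (hτ : 0 < τ.im) (hn : 3 ≤ n) {x y c : ℂ}
    (hc : c ≠ 0)
    (h : ∀ g ∈ quasiPeriodic τ (cexp (2 * Real.pi * I * μ)) (cexp (2 * Real.pi * I * ν)) n,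
      g x = c * g y) : ∃ k l : ℤ, x - y = k * τ + l := by
  obtain ⟨m, rfl⟩ := Nat.exists_eq_add_of_le' hn
  have hd := differentiable_jacobiTheta₂_left hτ
  have hsub : ∀ x : ℂ, Differentiable ℂ fun z => jacobiTheta₂ (x - z) τ :=
    fun x => hd.comp (by fun_prop)
  have hadd : ∀ x : ℂ, Differentiable ℂ fun z => jacobiTheta₂ (x + z) τ :=
    fun x => hd.comp (by fun_prop)
  obtain ⟨e, hex, hey⟩ := exists_ne_zero_and_ne_zero (hsub x) (hsub y)
    (exists_jacobiTheta₂_sub_ne_zero hτ x) (exists_jacobiTheta₂_sub_ne_zero hτ y)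
  have hX : cexp (2 * Real.pi * I * μ * x) * jacobiTheta₂ (x - e) τ ^ m ≠ 0 :=
    mul_ne_zero (Complex.exp_ne_zero _) (pow_ne_zero _ hex)
  have hY : cexp (2 * Real.pi * I * μ * y) * jacobiTheta₂ (y - e) τ ^ m ≠ 0 :=
    mul_ne_zero (Complex.exp_ne_zero _) (pow_ne_zero _ hey)
  obtain ⟨k, l, hkl⟩ := exists_eq_exp_mul_of_mul_mul (hsub x) (hsub y)
    (hadd (x - (ν - μ * τ - m * e))) (hadd (y - (ν - μ * τ - m * e)))
    (exists_jacobiTheta₂_sub_ne_zero hτ x) (exists_jacobiTheta₂_sub_ne_zero hτ y)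
    (exists_jacobiTheta₂_add_ne_zero hτ _) (exists_jacobiTheta₂_add_ne_zero hτ _)
    (div_ne_zero (mul_ne_zero hc hY) hX) (fun a b => by
      have := h _ (thetaProduct_mem hτ μ ν e m a b)
      simp only [thetaProduct] at this
      apply mul_left_cancel₀ hX
      rw [← mul_assoc _ (_ / _), mul_div_cancel₀ _ hX]
      linear_combination this)
  refine exists_int_of_jacobiTheta₂_add_eq hτ (k := -k) (l := l * cexp (k * y)) fun z => ?_
  have := hkl (y - z)
  rw [show x - (y - z) = z + (x - y) by ring, show y - (y - z) = z by ring] at this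
  rw [this, show k * (y - z) = k * y + -k * z by ring, Complex.exp_add]
  ring

/-- Infinitesimal form of the separation of points. If `w ≠ 0`, the logarithmic derivative at `x` of
every theta product is `c / w`; subtracting that of the fixed factor `f` leaves the additive
functional equation for `θ'/θ`. -/
theorem eq_zero_of_quasiPeriodic_deriv (hτ : 0 < τ.im) (hn : 3 ≤ n) {x w c : ℂ}
    (h : ∀ g ∈ quasiPeriodic τ (cexp (2 * Real.pi * I * μ)) (cexp (2 * Real.pi * I * ν)) n,
      deriv g x * w = c * g x) : w = 0 := by
  by_contra hw
  obtain ⟨m, rfl⟩ := Nat.exists_eq_add_of_le' hn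
  have hd := differentiable_jacobiTheta₂_left hτ
  have hd' := differentiable_jacobiTheta₂'_left hτ
  obtain ⟨e, he⟩ := exists_jacobiTheta₂_sub_ne_zero hτ x
  set f : ℂ → ℂ := fun z => cexp (2 * Real.pi * I * μ * z) * jacobiTheta₂ (z - e) τ ^ m with hf
  have hfx : f x ≠ 0 := mul_ne_zero (Complex.exp_ne_zero _) (pow_ne_zero _ he)
  have hfd : Differentiable ℂ f :=
    Differentiable.mul (by fun_prop) (Differentiable.pow (hd.comp (by fun_prop)) m)
  obtain ⟨k, l, hkl⟩ := exists_eq_affine_mul_of_add (p := fun z => jacobiTheta₂ (x - z) τ)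
    (q := fun z => jacobiTheta₂' (x - z) τ)
    (r := fun z => jacobiTheta₂ (x - (ν - μ * τ - m * e) + z) τ)
    (s := fun z => jacobiTheta₂' (x - (ν - μ * τ - m * e) + z) τ)
    (hd.comp (by fun_prop)) (hd'.comp (by fun_prop)) (hd.comp (by fun_prop))
    (exists_jacobiTheta₂_sub_ne_zero hτ x) (exists_jacobiTheta₂_add_ne_zero hτ _)
    (c := c / w - deriv f x / f x) (fun a b => by
      have h1 := h _ (thetaProduct_mem hτ μ ν e m a b)
      have hsub : ∀ a : ℂ, HasDerivAt (fun z => jacobiTheta₂ (z - a) τ)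
          (jacobiTheta₂' (x - a) τ) x := fun a =>
        (hasDerivAt_jacobiTheta₂_fst (x - a) hτ).comp_sub_const x a
      have h2 : HasDerivAt (thetaProduct τ μ (ν - μ * τ) e m a b) _ x :=
        (hfd x).hasDerivAt.mul (((hsub a).mul (hsub b)).mul
          (((hasDerivAt_jacobiTheta₂_fst (x - (ν - μ * τ - m * e) + (a + b)) hτ).comp_add_const
            (x - (ν - μ * τ - m * e)) (a + b)).comp_sub_const x (ν - μ * τ - m * e)))
      rw [h2.deriv] at h1
      simp only [thetaProduct, Pi.mul_apply] at h1
      rw [← show f x = cexp (2 * Real.pi * I * μ * x) * jacobiTheta₂ (x - e) τ ^ m from rfl] at h1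
      field_simp
      linear_combination h1)
  refine jacobiTheta₂'_ne_affine_mul hτ (k := -k) (l := k * x + l) fun z => ?_
  have := hkl (x - z)
  simp only [sub_sub_cancel] at this
  rw [this]
  ring

/-- With a single factor there is no freedom: the translation is the whole sum `ν - μτ`. -/
theorem exists_mem_quasiPeriodic_one_ne_zero (hτ : 0 < τ.im) (μ ν : ℂ) :
    ∃ g ∈ quasiPeriodic τ (cexp (2 * Real.pi * I * μ)) (cexp (2 * Real.pi * I * ν)) 1,
      ∃ x, g x ≠ 0 := by
  have hd := differentiable_jacobiTheta₂_left hτ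
  refine ⟨fun z => cexp (2 * Real.pi * I * μ * z) * jacobiTheta₂ (z - (ν - μ * τ)) τ,
    ⟨Differentiable.mul (by fun_prop) (hd.comp (by fun_prop)), fun z => ?_, fun z => ?_⟩, ?_⟩
  · simp only
    rw [show z + 1 - (ν - μ * τ) = z - (ν - μ * τ) + 1 by ring, jacobiTheta₂_add_left, mul_add,
      Complex.exp_add, mul_one]
    ring
  · simp only [jacobiTheta₂_sub_add_left]
    rw [← mul_assoc, ← mul_assoc, ← Complex.exp_add, ← Complex.exp_add, ← Complex.exp_add]
    congr 2
    push_cast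
    ring
  · obtain ⟨z, hz⟩ := exists_jacobiTheta₂_ne_zero hτ
    exact ⟨z + (ν - μ * τ), mul_ne_zero (Complex.exp_ne_zero _) (by simpa using hz)⟩

end ThetaProduct

/-! ### Projective space -/

theorem affineChart_mk {N : ℕ} (j : Fin (N + 1)) (v : Fin (N + 1) → ℂ) (hv : v ≠ 0) :
    affineChart j (Projectivization.mk ℂ v hv) = fun i => v i / v j := by
  obtain ⟨a, ha⟩ := Projectivization.exists_smul_eq_mk_rep ℂ v hv
  funext i
  simp only [affineChart, ← ha, Pi.smul_apply, Units.smul_def, smul_eq_mul]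
  exact mul_div_mul_left _ _ a.ne_zero

theorem rep_mk_apply_ne_zero_iff {N : ℕ} (j : Fin (N + 1)) (v : Fin (N + 1) → ℂ) (hv : v ≠ 0) :
    (Projectivization.mk ℂ v hv).rep j ≠ 0 ↔ v j ≠ 0 := by
  obtain ⟨a, ha⟩ := Projectivization.exists_smul_eq_mk_rep ℂ v hv
  simp [← ha, Units.smul_def]

/-- The matrix `(v_i conj v_j / ∑ |v_k|²)` of the orthogonal projection onto a line `[v]`. -/
noncomputable def projectionMatrix (N : ℕ) (p : ℙ ℂ (Fin (N + 1) → ℂ)) :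
    Fin (N + 1) × Fin (N + 1) → ℂ :=
  Projectivization.lift
    (fun (v : {v : Fin (N + 1) → ℂ // v ≠ 0}) (ij : Fin (N + 1) × Fin (N + 1)) =>
      v.1 ij.1 * conj (v.1 ij.2) / (∑ k, v.1 k * conj (v.1 k)))
    (by
      rintro ⟨v, hv⟩ ⟨w, hw⟩ t rfl
      have ht : t ≠ 0 := by rintro rfl; simp at hv
      have ht' : t * conj t ≠ 0 := mul_ne_zero ht (by simpa using ht)
      funext ij
      simp only [Pi.smul_apply, smul_eq_mul, map_mul]
      rw [← mul_div_mul_left (w ij.1 * conj (w ij.2)) _ ht', Finset.mul_sum]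
      congr 1
      · ring
      · exact Finset.sum_congr rfl fun k _ => by ring) p

theorem sum_mul_conj_ne_zero {ι : Type*} [Fintype ι] {v : ι → ℂ} (hv : v ≠ 0) :
    ∑ k, v k * conj (v k) ≠ 0 := by
  simp only [Complex.mul_conj]
  rw [← Complex.ofReal_sum, Complex.ofReal_ne_zero]
  obtain ⟨i, hi⟩ := Function.ne_iff.1 hv
  exact (Finset.sum_pos' (fun k _ => Complex.normSq_nonneg _)
    ⟨i, Finset.mem_univ i, Complex.normSq_pos.2 hi⟩).ne'

/-- A line is determined by its orthogonal projection, which depends continuously on it, so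
projective space injects continuously into a Hausdorff space of matrices. -/
instance projectiveSpace_t2Space (N : ℕ) : T2Space (ℙ ℂ (Fin (N + 1) → ℂ)) := by
  refine T2Space.of_injective_continuous (f := projectionMatrix N) ?_ ?_
  · intro p q
    induction p with | h v hv
    induction q with | h w hw
    intro h
    obtain ⟨j, hj⟩ := Function.ne_iff.1 hv
    rw [Pi.zero_apply] at hj
    have hij : ∀ i, v i * conj (v j) / (∑ k, v k * conj (v k)) =
        w i * conj (w j) / (∑ k, w k * conj (w k)) := fun i => congrFun h (i, j)
    have hv' := sum_mul_conj_ne_zero hv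
    have hw' := sum_mul_conj_ne_zero hw
    have hcj : conj (v j) ≠ 0 := by simpa using hj
    rw [Projectivization.mk_eq_mk_iff']
    -- Column `j` of the matrix is a multiple of `v` and of `w`; the scalar is the ratio of the two
    -- multiples.
    refine ⟨conj (w j) / (∑ k, w k * conj (w k)) * (∑ k, v k * conj (v k)) / conj (v j), ?_⟩
    funext i
    have := hij i
    rw [Pi.smul_apply, smul_eq_mul]
    field_simp at this ⊢
    linear_combination -this
  · refine continuous_coinduced_dom.2 ?_
    refine continuous_pi fun ij => ?_
    change Continuous fun v : {v : Fin (N + 1) → ℂ // v ≠ 0} =>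
      v.1 ij.1 * conj (v.1 ij.2) / (∑ k, v.1 k * conj (v.1 k))
    refine Continuous.div ?_ ?_ fun v => sum_mul_conj_ne_zero v.2
    · have h1 : Continuous fun v : {v : Fin (N + 1) → ℂ // v ≠ 0} => v.1 ij.1 :=
        (continuous_apply _).comp continuous_subtype_val
      have h2 : Continuous fun v : {v : Fin (N + 1) → ℂ // v ≠ 0} => v.1 ij.2 :=
        (continuous_apply _).comp continuous_subtype_val
      exact h1.mul (Complex.continuous_conj.comp h2)
    · refine continuous_finsetSum _ fun k _ => ?_
      have h1 : Continuous fun v : {v : Fin (N + 1) → ℂ // v ≠ 0} => v.1 k :=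
        (continuous_apply _).comp continuous_subtype_val
      exact h1.mul (Complex.continuous_conj.comp h1)

/-! ### Sections as theta functions -/

namespace HolLineBundle

variable {Λ : AddSubgroup CC}

/-- The factor of automorphy of `M`. -/
def factor (M : HolLineBundle Λ) {α : CC} (hα : α ∈ Λ) (z : CC) : ℂ :=
  M.triv (z : CC ⧸ Λ) (z + α) (QuotientAddGroup.mk_add_of_mem z hα)
    ((M.triv (z : CC ⧸ Λ) z rfl).symm 1)

/-- The theta functions of `M`: the pull-backs to `ℂ²` of the sections of `M`. -/
def thetaFunctions (M : HolLineBundle Λ) : Submodule ℂ (CC → ℂ) where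
  carrier := {F | Differentiable ℂ F ∧
    ∀ (α : CC) (hα : α ∈ Λ) (z : CC), F (z + α) = M.factor hα z * F z}
  zero_mem' := ⟨differentiable_const 0, by simp⟩
  add_mem' := by
    rintro F G ⟨hF, hF'⟩ ⟨hG, hG'⟩
    refine ⟨hF.add hG, fun α hα z => ?_⟩
    simp only [Pi.add_apply, hF' α hα, hG' α hα]
    ring
  smul_mem' := by
    rintro c F ⟨hF, hF'⟩
    refine ⟨hF.const_smul c, fun α hα z => ?_⟩
    simp only [Pi.smul_apply, smul_eq_mul, hF' α hα]
    ring

theorem triv_add (M : HolLineBundle Λ) {α : CC} (hα : α ∈ Λ) (z : CC)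
    (v : M.Fiber (z : CC ⧸ Λ)) :
    M.triv (z : CC ⧸ Λ) (z + α) (QuotientAddGroup.mk_add_of_mem z hα) v =
      M.factor hα z * M.triv (z : CC ⧸ Λ) z rfl v := by
  have : v = (M.triv (z : CC ⧸ Λ) z rfl v) • (M.triv (z : CC ⧸ Λ) z rfl).symm 1 := by
    apply (M.triv (z : CC ⧸ Λ) z rfl).injective
    simp
  conv_lhs => rw [this, map_smul, smul_eq_mul, mul_comm]
  rfl

theorem triv_section (M : HolLineBundle Λ) (s : ∀ x, M.Fiber x) {x : CC ⧸ Λ} {z : CC}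
    (h : (z : CC ⧸ Λ) = x) : M.triv x z h (s x) = M.triv (z : CC ⧸ Λ) z rfl (s z) := by
  subst h; rfl

/-- The section with pull-back `F`. -/
noncomputable def sectionOf (M : HolLineBundle Λ) (F : CC → ℂ) (x : CC ⧸ Λ) : M.Fiber x :=
  (M.triv x (Quotient.out x) (Quotient.out_eq x)).symm (F (Quotient.out x))

theorem triv_sectionOf (M : HolLineBundle Λ) {F : CC → ℂ} (hF : F ∈ M.thetaFunctions) (z : CC) :
    M.triv (z : CC ⧸ Λ) z rfl (M.sectionOf F z) = F z := by
  -- An arbitrary representative `w` replaces `Quotient.out`, so that `x` can be substituted away.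
  -- The functional equation of `F` compensates the change of representative.
  have key : ∀ (x : CC ⧸ Λ) (w : CC) (hw : (w : CC ⧸ Λ) = x) (hz : (z : CC ⧸ Λ) = x),
      M.triv x z hz ((M.triv x w hw).symm (F w)) = F z := by
    rintro x w rfl hz
    have hα : z - w ∈ Λ := by
      rw [sub_eq_neg_add]
      exact QuotientAddGroup.eq.1 hz.symm
    obtain ⟨α, rfl⟩ : ∃ α, z = w + α := ⟨z - w, by simp⟩
    rw [add_sub_cancel_left] at hα
    rw [M.triv_add hα, LinearEquiv.apply_symm_apply, hF.2 α hα]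
  exact key _ _ _ _

/-- Sections are the same as theta functions. -/
noncomputable def sectionsEquiv (M : HolLineBundle Λ) : M.sections ≃ₗ[ℂ] M.thetaFunctions where
  toFun s := ⟨fun z => M.triv (z : CC ⧸ Λ) z rfl (s.1 z), s.2, fun α hα z => by
    rw [← M.triv_add hα]
    exact (M.triv_section s.1 _).symm⟩
  map_add' s t := by ext z; simp
  map_smul' c s := by ext z; simp
  invFun F := ⟨M.sectionOf F, by
    change Differentiable ℂ fun z : CC => M.triv (z : CC ⧸ Λ) z rfl (M.sectionOf F z)
    simp only [M.triv_sectionOf F.2]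
    exact F.2.1⟩
  left_inv s := by
    ext x
    obtain ⟨z, rfl⟩ := QuotientAddGroup.mk_surjective x
    apply (M.triv (z : CC ⧸ Λ) z rfl).injective
    refine M.triv_sectionOf (F := fun z => M.triv (z : CC ⧸ Λ) z rfl (s.1 z)) ⟨s.2, ?_⟩ z
    intro α hα z
    rw [← M.triv_add hα]
    exact (M.triv_section s.1 _).symm
  right_inv F := by
    ext z
    exact M.triv_sectionOf F.2 z

theorem sectionsEquiv_apply (M : HolLineBundle Λ) (s : M.sections) (z : CC) :
    (M.sectionsEquiv s : CC → ℂ) z = M.triv (z : CC ⧸ Λ) z rfl (s.1 z) := rfl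

/-- If the theta functions of `M` form a finite-dimensional space without base points which
separates points and tangent vectors, then `M` is very ample. -/
theorem isVeryAmple_of_separates (M : HolLineBundle Λ) [CompactSpace (CC ⧸ Λ)]
    [FiniteDimensional ℂ M.thetaFunctions]
    (hne : ∀ z, ∃ F ∈ M.thetaFunctions, F z ≠ 0)
    (hpt : ∀ (z w : CC) (c : ℂ), c ≠ 0 → (∀ F ∈ M.thetaFunctions, F z = c * F w) → z - w ∈ Λ)
    (htan : ∀ (z u : CC) (c : ℂ), (∀ F ∈ M.thetaFunctions, fderiv ℂ F z u = c * F z) → u = 0) :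
    M.IsVeryAmple := by
  have : FiniteDimensional ℂ M.sections := FiniteDimensional.of_injective
    M.sectionsEquiv.toLinearMap M.sectionsEquiv.injective
  obtain ⟨N, hN⟩ : ∃ N, Module.finrank ℂ M.sections = N + 1 := by
    apply Nat.exists_eq_succ_of_ne_zero
    obtain ⟨F, hF, hF0⟩ := hne 0
    have : Nontrivial M.sections := by
      refine ⟨M.sectionsEquiv.symm ⟨F, hF⟩, 0, fun h => hF0 ?_⟩
      rw [LinearEquiv.symm_apply_eq, map_zero] at h
      exact congrFun (congrArg Subtype.val h) 0
    exact Module.finrank_pos.ne'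
  let s : Module.Basis (Fin (N + 1)) ℂ M.sections := Module.finBasisOfFinrankEq ℂ _ hN
  let b := s.map M.sectionsEquiv
  let G : CC → Fin (N + 1) → ℂ := fun z i => (b i : CC → ℂ) z
  have hGd : ∀ i, Differentiable ℂ fun z => G z i := fun i => (b i).2.1
  have hGs : ∀ z i, G z i = M.triv (z : CC ⧸ Λ) z rfl ((s i : ∀ x, M.Fiber x) z) := by
    intro z i
    simp only [G, b, Module.Basis.map_apply, M.sectionsEquiv_apply]
  have hGc : Continuous G := continuous_pi fun i => (hGd i).continuous
  -- This passes from the coordinates of the map, which are basis elements, to the hypotheses, which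
  -- speak of all theta functions.
  have hext : ∀ φ : M.thetaFunctions →ₗ[ℂ] ℂ, (∀ i, φ (b i) = 0) → ∀ F, φ F = 0 := by
    intro φ h F
    have : φ = 0 := b.ext fun i => by rw [h i, LinearMap.zero_apply]
    rw [this, LinearMap.zero_apply]
  let ev : CC → M.thetaFunctions →ₗ[ℂ] ℂ := fun z =>
    (LinearMap.proj z).comp M.thetaFunctions.subtype
  have hG0 : ∀ z, G z ≠ 0 := by
    intro z h
    obtain ⟨F, hF, hF0⟩ := hne z
    exact hF0 (hext (ev z) (fun i => congrFun h i) ⟨F, hF⟩)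
  have hfib : ∀ (x : CC ⧸ Λ) (e e' : M.Fiber x ≃ₗ[ℂ] ℂ),
      ∃ c : ℂ, c ≠ 0 ∧ ∀ v, e v = c * e' v := by
    intro x e e'
    refine ⟨e (e'.symm 1), by simp, fun v => ?_⟩
    have : v = (e' v) • e'.symm 1 := by
      apply e'.injective
      simp
    conv_lhs => rw [this, map_smul, smul_eq_mul, mul_comm]
  have he : ∀ (x : CC ⧸ Λ) (e : M.Fiber x ≃ₗ[ℂ] ℂ),
      (fun i => e ((s i : ∀ x, M.Fiber x) x)) ≠ 0 := by
    intro x e h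
    obtain ⟨z, rfl⟩ := QuotientAddGroup.mk_surjective x
    obtain ⟨c, -, hc⟩ := hfib _ (M.triv (z : CC ⧸ Λ) z rfl) e
    apply hG0 z
    funext i
    have := congrFun h i
    rw [Pi.zero_apply] at this ⊢
    rw [hGs, hc, this, mul_zero]
  let f : CC ⧸ Λ → ℙ ℂ (Fin (N + 1) → ℂ) := fun x => Projectivization.mk ℂ _
    (he x (M.triv x (Quotient.out x) (Quotient.out_eq x)))
  have hfe : ∀ (x : CC ⧸ Λ) (e : M.Fiber x ≃ₗ[ℂ] ℂ), f x = Projectivization.mk ℂ _ (he x e) := by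
    intro x e
    rw [Projectivization.mk_eq_mk_iff']
    obtain ⟨c, -, hc⟩ := hfib x (M.triv x (Quotient.out x) (Quotient.out_eq x)) e
    exact ⟨c, funext fun i => (hc _).symm⟩
  have hf : ∀ z : CC, f z = Projectivization.mk ℂ (G z) (hG0 z) :=
    fun z => hfe z (M.triv (z : CC ⧸ Λ) z rfl)
  have hcont : Continuous f := by
    rw [(QuotientAddGroup.isOpenQuotientMap_mk (N := Λ)).isQuotientMap.continuous_iff]
    have h1 : Continuous (Projectivization.mk' ℂ : {v : Fin (N + 1) → ℂ // v ≠ 0} → _) :=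
      continuous_coinduced_rng
    have h2 : Continuous fun z : CC => (⟨G z, hG0 z⟩ : {v : Fin (N + 1) → ℂ // v ≠ 0}) :=
      hGc.subtype_mk _
    convert h1.comp h2 using 1
    funext z
    exact hf z
  have hinj : Function.Injective f := by
    intro x y hxy
    obtain ⟨z, rfl⟩ := QuotientAddGroup.mk_surjective x
    obtain ⟨w, rfl⟩ := QuotientAddGroup.mk_surjective y
    rw [hf, hf, Projectivization.mk_eq_mk_iff] at hxy
    obtain ⟨a, ha⟩ := hxy
    have hmem := hpt z w a a.ne_zero fun F hF => by
      have := hext (ev z - (a : ℂ) • ev w) (fun i => by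
        have := congrFun ha i
        rw [Pi.smul_apply, Units.smul_def, smul_eq_mul] at this
        change G z i - a * G w i = 0
        rw [this, sub_self]) ⟨F, hF⟩
      exact sub_eq_zero.1 this
    rw [eq_comm, QuotientAddGroup.eq, ← sub_eq_neg_add]
    exact hmem
  have hchart : ∀ j, (fun w : CC => affineChart j (f w)) = fun w i => G w i / G w j := by
    intro j
    funext w
    rw [hf, affineChart_mk]
  have hdiff : ∀ (z : CC) (j : Fin (N + 1)), (f z).rep j ≠ 0 →
      DifferentiableAt ℂ (fun w : CC => affineChart j (f w)) z := by
    intro z j hj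
    rw [hf, rep_mk_apply_ne_zero_iff] at hj
    rw [hchart]
    refine differentiableAt_pi.2 fun i => ?_
    simp only [div_eq_mul_inv]
    exact (hGd i z).mul ((hGd j z).inv hj)
  refine ⟨N, s, f, fun x e => ⟨he x e, hfe x e⟩, hcont.isClosedEmbedding hinj, hdiff, ?_⟩
  intro z j hj
  have hd := (hdiff z j hj).hasFDerivAt
  set L := fderiv ℂ (fun w : CC => affineChart j (f w)) z
  rw [hchart] at hd
  rw [hf, rep_mk_apply_ne_zero_iff] at hj
  rw [injective_iff_map_eq_zero]
  intro u hu
  let D : M.thetaFunctions →ₗ[ℂ] ℂ :=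
    { toFun := fun F => fderiv ℂ (F : CC → ℂ) z u
      map_add' := fun F F' => by
        rw [Submodule.coe_add, fderiv_add (F.2.1 z) (F'.2.1 z)]; rfl
      map_smul' := fun c F => by
        rw [Submodule.coe_smul, fderiv_const_smul (F.2.1 z)]; rfl }
  -- If all ratios `G_i / G_j` have zero derivative along `u`, the product rule gives every `G_i`
  -- the logarithmic derivative of `G_j` along `u`.
  refine htan z u (fderiv ℂ (fun w => G w j) z u / G z j) fun F hF => ?_
  have := hext (D - (fderiv ℂ (fun w => G w j) z u / G z j) • ev z) (fun i => by
    have h1 := (hasFDerivAt_pi'.1 hd i).mul (hGd j z).hasFDerivAt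
    have h2 : (fun w => G w i) =ᶠ[nhds z] fun w => (G w i / G w j) * G w j := by
      filter_upwards [(hGd j).continuous.continuousAt.eventually_ne hj] with w hw
      rw [div_mul_cancel₀ _ hw]
    have h3 := (h1.congr_of_eventuallyEq h2).fderiv
    change fderiv ℂ (fun w => G w i) z u - _ / _ * G z i = 0
    rw [h3]
    simp [hu]
    field_simp
    simp) ⟨F, hF⟩
  exact sub_eq_zero.1 this

end HolLineBundle

/-! ### The lattice of `diag(τ, τ)` -/

section Lattice

variable {τ : ℂ}

theorem mem_periodLattice_diagPeriod {z : CC} :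
    z ∈ periodLattice (diagPeriod τ) ↔ ∀ j, ∃ m n : ℤ, z j = m * τ + n := by
  constructor
  · rintro ⟨m, n, rfl⟩ j
    refine ⟨m j, n j, ?_⟩
    fin_cases j <;> simp [diagPeriod, Matrix.vecHead, Matrix.vecTail]
  · intro h
    choose m n h using h
    refine ⟨m, n, ?_⟩
    ext j
    rw [h j]
    fin_cases j <;> simp [diagPeriod, Matrix.vecHead, Matrix.vecTail]

theorem single_mem_periodLattice (j : Fin 2) {t : ℂ} (ht : ∃ m n : ℤ, t = m * τ + n) :
    Pi.single j t ∈ periodLattice (diagPeriod τ) := by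
  rw [mem_periodLattice_diagPeriod]
  intro i
  by_cases h : i = j
  · subst h; simpa using ht
  · exact ⟨0, 0, by simp [h]⟩

theorem single_one_mem_periodLattice (j : Fin 2) :
    Pi.single j 1 ∈ periodLattice (diagPeriod τ) :=
  single_mem_periodLattice j ⟨0, 1, by simp⟩

theorem single_tau_mem_periodLattice (j : Fin 2) :
    Pi.single j τ ∈ periodLattice (diagPeriod τ) :=
  single_mem_periodLattice j ⟨1, 0, by simp⟩

theorem latticeBasis_eq : latticeBasis τ =
    ![Pi.single 0 τ, Pi.single 1 τ, Pi.single 0 1, Pi.single 1 1] := by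
  funext i j
  fin_cases i <;> fin_cases j <;> simp [latticeBasis]

theorem closure_latticeBasis :
    AddSubgroup.closure (Set.range (latticeBasis τ)) = periodLattice (diagPeriod τ) := by
  apply le_antisymm
  · rw [AddSubgroup.closure_le, latticeBasis_eq]
    rintro _ ⟨i, rfl⟩
    fin_cases i
    · exact single_tau_mem_periodLattice 0
    · exact single_tau_mem_periodLattice 1
    · exact single_one_mem_periodLattice 0
    · exact single_one_mem_periodLattice 1
  · intro z hz
    choose m n h using mem_periodLattice_diagPeriod.1 hz
    have : z = m 0 • latticeBasis τ 0 + m 1 • latticeBasis τ 1 + n 0 • latticeBasis τ 2 +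
        n 1 • latticeBasis τ 3 := by
      ext j
      rw [h j]
      fin_cases j <;> simp [latticeBasis]
    rw [this]
    have hs : ∀ i, latticeBasis τ i ∈ AddSubgroup.closure (Set.range (latticeBasis τ)) :=
      fun i => AddSubgroup.subset_closure ⟨i, rfl⟩
    exact add_mem (add_mem (add_mem (zsmul_mem (hs 0) _) (zsmul_mem (hs 1) _))
      (zsmul_mem (hs 2) _)) (zsmul_mem (hs 3) _)

theorem linearIndependent_latticeBasis (hτ : 0 < τ.im) :
    LinearIndependent ℝ (latticeBasis τ) := by
  rw [Fintype.linearIndependent_iff]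
  intro g hg
  have h0 := congrFun hg 0
  have h1 := congrFun hg 1
  simp only [Fin.sum_univ_four, latticeBasis] at h0 h1
  have h0i := congrArg Complex.im h0
  have h1i := congrArg Complex.im h1
  have h0r := congrArg Complex.re h0
  have h1r := congrArg Complex.re h1
  simp [hτ.ne'] at h0i h1i h0r h1r
  rw [h0i] at h0r
  rw [h1i] at h1r
  simp at h0r h1r
  intro i
  fin_cases i <;> assumption

theorem formH_latticeBasis_im (hτ : 0 < τ.im) :
    (Matrix.of fun i j => (formH τ (latticeBasis τ i) (latticeBasis τ j)).im) =
      !![0, 0, 1, 0;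
         0, 0, 0, 1;
         -1, 0, 0, 0;
         0, -1, 0, 0] := by
  have h : τ.im ≠ 0 := hτ.ne'
  have h1 : (1 / (τ.im : ℂ)) = ((1 / τ.im : ℝ) : ℂ) := by push_cast; rfl
  ext i j
  rw [Matrix.of_apply, formH, h1, Complex.im_ofReal_mul]
  fin_cases i <;> fin_cases j <;> simp [latticeBasis, h, mul_comm]

theorem formH_self_re (z : CC) :
    (formH τ z z).re = 1 / τ.im * (Complex.normSq (z 0) + Complex.normSq (z 1)) := by
  have h1 : (1 / (τ.im : ℂ)) = ((1 / τ.im : ℝ) : ℂ) := by push_cast; rfl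
  rw [formH, h1, Complex.re_ofReal_mul, Complex.mul_conj, Complex.mul_conj]
  simp

theorem isPosDefForm_formH (hτ : 0 < τ.im) : IsPosDefForm (formH τ) := by
  intro z hz
  rw [formH_self_re]
  refine mul_pos (by positivity) ?_
  obtain ⟨j, hj⟩ := Function.ne_iff.1 hz
  have h0 := Complex.normSq_nonneg (z 0)
  have h1 := Complex.normSq_nonneg (z 1)
  have h2 := Complex.normSq_pos.2 hj
  fin_cases j <;> simp only [Fin.zero_eta, Fin.mk_one] at h2 <;> linarith

/-- In these real coordinates `E` is the standard symplectic form. This yields both integrality on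
the lattice and the exponent in the semi-character law. -/
theorem formH_im {α β : CC} (hτ : 0 < τ.im) {m n m' n' : Fin 2 → ℝ}
    (hα : ∀ j, α j = m j * τ + n j) (hβ : ∀ j, β j = m' j * τ + n' j) :
    (formH τ α β).im = m 0 * n' 0 - n 0 * m' 0 + (m 1 * n' 1 - n 1 * m' 1) := by
  have h1 : (1 / (τ.im : ℂ)) = ((1 / τ.im : ℝ) : ℂ) := by push_cast; rfl
  rw [formH, h1, Complex.im_ofReal_mul, hα, hα, hβ, hβ]
  simp
  field_simp
  ring

theorem isRiemannForm_formH (hτ : 0 < τ.im) :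
    IsRiemannForm (periodLattice (diagPeriod τ)) (formH τ) where
  add_left z z' w := by simp only [formH, Pi.add_apply]; ring
  smul_left c z w := by simp only [formH, Pi.smul_apply, smul_eq_mul]; ring
  conj_symm z w := by
    simp only [formH, map_mul, map_add, map_div₀, map_one, Complex.conj_ofReal,
      Complex.conj_conj]
    ring
  nondegenerate z h := by
    by_contra hz
    have := isPosDefForm_formH hτ z hz
    rw [h z] at this
    simp at this
  integral α hα β hβ := by
    choose m n h using mem_periodLattice_diagPeriod.1 hα
    choose m' n' h' using mem_periodLattice_diagPeriod.1 hβ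
    refine ⟨m 0 * n' 0 - n 0 * m' 0 + (m 1 * n' 1 - n 1 * m' 1), ?_⟩
    rw [formH_im hτ (m := fun j => m j) (n := fun j => n j) (m' := fun j => m' j)
      (n' := fun j => n' j) (by simpa using h) (by simpa using h')]
    push_cast
    rfl

theorem exists_real_coordinates (hτ : 0 < τ.im) (z : ℂ) :
    ∃ a b : ℝ, z = a * τ + b := by
  refine ⟨z.im / τ.im, z.re - z.im / τ.im * τ.re, ?_⟩
  have := hτ.ne'
  apply Complex.ext <;> simp
  field_simp

theorem eq_of_real_coordinates (hτ : 0 < τ.im) {a b a' b' : ℝ}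
    (h : (a * τ + b : ℂ) = a' * τ + b') : a = a' ∧ b = b' := by
  have hi := congrArg Complex.im h
  have hr := congrArg Complex.re h
  simp [hτ.ne'] at hi
  simp [hi] at hr
  exact ⟨hi, hr⟩

/-- The sign `(-1)^(m·n)` works, since `(m + m')·(n + n') - m·n - m'·n' = m·n' + n·m'` is congruent
to `E = m·n' - n·m'` modulo `2`. -/
theorem exists_isSemiCharacter (hτ : 0 < τ.im) :
    ∃ χ, IsSemiCharacter (periodLattice (diagPeriod τ)) (formH τ) χ := by
  choose m n h using fun α : periodLattice (diagPeriod τ) => mem_periodLattice_diagPeriod.1 α.2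
  refine ⟨fun α => Circle.exp (Real.pi * (m α 0 * n α 0 + m α 1 * n α 1)), fun α β => ?_⟩
  have hadd : ∀ j, m (α + β) j = m α j + m β j ∧ n (α + β) j = n α j + n β j := by
    intro j
    have h1 := h (α + β) j
    rw [AddSubgroup.coe_add, Pi.add_apply, h α j, h β j] at h1
    have := eq_of_real_coordinates hτ (a := m (α + β) j) (b := n (α + β) j)
      (a' := m α j + m β j) (b' := n α j + n β j) (by
        push_cast
        rw [← h1]; ring)
    exact_mod_cast this
  rw [formH_im hτ (m := fun j => m α j) (n := fun j => n α j) (m' := fun j => m β j)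
      (n' := fun j => n β j) (by simpa using h α) (by simpa using h β)]
  simp only [Circle.coe_exp, (hadd _).1, (hadd _).2, ← Complex.exp_add]
  rw [Complex.exp_eq_exp_iff_exists_int]
  -- The two exponents differ by `2πi` times `n·m'`.
  refine ⟨n α 0 * m β 0 + n α 1 * m β 1, ?_⟩
  push_cast
  ring

/-- Taking fractional parts of the real coordinates shows that the torus is the image of a closed
unit cube. -/
theorem compactSpace_quotient (hτ : 0 < τ.im) :
    CompactSpace (CC ⧸ periodLattice (diagPeriod τ)) := by
  let φ : (Fin 2 → ℝ) × (Fin 2 → ℝ) → CC := fun p j => p.1 j * τ + p.2 j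
  have hφ : Continuous φ := by fun_prop
  have hc : Continuous fun p => (φ p : CC ⧸ periodLattice (diagPeriod τ)) :=
    continuous_quotient_mk'.comp hφ
  refine ⟨?_⟩
  have hK : IsCompact ((Set.Icc 0 1 : Set (Fin 2 → ℝ)) ×ˢ (Set.Icc 0 1 : Set (Fin 2 → ℝ))) :=
    isCompact_Icc.prod isCompact_Icc
  convert hK.image hc
  symm
  rw [Set.eq_univ_iff_forall]
  intro x
  obtain ⟨z, rfl⟩ := QuotientAddGroup.mk_surjective x
  choose a b hab using fun j => exists_real_coordinates hτ (z j)
  refine ⟨(fun j => Int.fract (a j), fun j => Int.fract (b j)), ⟨⟨?_, ?_⟩, ⟨?_, ?_⟩⟩, ?_⟩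
  · exact fun j => Int.fract_nonneg _
  · exact fun j => (Int.fract_lt_one _).le
  · exact fun j => Int.fract_nonneg _
  · exact fun j => (Int.fract_lt_one _).le
  · rw [QuotientAddGroup.eq, mem_periodLattice_diagPeriod]
    intro j
    refine ⟨⌊a j⌋, ⌊b j⌋, ?_⟩
    simp only [φ, Pi.add_apply, Pi.neg_apply, hab j]
    have h1 : ((Int.fract (a j) : ℝ) : ℂ) + (⌊a j⌋ : ℂ) = a j := by
      exact_mod_cast congrArg Complex.ofReal (Int.fract_add_floor (a j))
    have h2 : ((Int.fract (b j) : ℝ) : ℂ) + (⌊b j⌋ : ℂ) = b j := by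
      exact_mod_cast congrArg Complex.ofReal (Int.fract_add_floor (b j))
    linear_combination -τ * h1 - h2

end Lattice

/-! ### Factors of automorphy -/

theorem factor_lineBundle {Λ : AddSubgroup CC} {H : CC → CC → ℂ} (hH : IsRiemannForm Λ H)
    {χ : Λ → Circle} (hχ : IsSemiCharacter Λ H χ) {α : CC} (hα : α ∈ Λ) (z : CC) :
    (lineBundle hH hχ).factor hα z = autFactor H χ ⟨α, hα⟩ z := by
  change autTriv hH hχ (z : CC ⧸ Λ) (z + α) (QuotientAddGroup.mk_add_of_mem z hα)
    ((autTriv hH hχ (z : CC ⧸ Λ) z rfl).symm 1) = autFactor H χ ⟨α, hα⟩ z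
  obtain ⟨f, hf⟩ := (autTriv hH hχ (z : CC ⧸ Λ) z rfl).surjective 1
  rw [← hf, LinearEquiv.symm_apply_apply]
  have h1 : f.1 ⟨z, rfl⟩ = 1 := hf
  have h2 := f.2 ⟨z, rfl⟩ ⟨z + α, QuotientAddGroup.mk_add_of_mem z hα⟩ ⟨α, hα⟩ rfl
  rw [h1, mul_one] at h2
  exact h2

theorem factor_tensorPower {Λ : AddSubgroup CC} (M : HolLineBundle Λ) (n : ℕ) {α : CC}
    (hα : α ∈ Λ) (z : CC) : (M.tensorPower n).factor hα z = M.factor hα z ^ n := by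
  change ((PiTensorProduct.congr fun _ : Fin n => M.triv (z : CC ⧸ Λ) (z + α) _).trans
      (PiTensorProduct.constantBaseRingEquiv (Fin n) ℂ).toLinearEquiv)
    (((PiTensorProduct.congr fun _ : Fin n => M.triv (z : CC ⧸ Λ) z rfl).trans
      (PiTensorProduct.constantBaseRingEquiv (Fin n) ℂ).toLinearEquiv).symm 1) = _
  have h1 : ((PiTensorProduct.congr fun _ : Fin n => M.triv (z : CC ⧸ Λ) z rfl).trans
      (PiTensorProduct.constantBaseRingEquiv (Fin n) ℂ).toLinearEquiv).symm 1 =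
      PiTensorProduct.tprod ℂ fun _ : Fin n => (M.triv (z : CC ⧸ Λ) z rfl).symm 1 := by
    rw [LinearEquiv.symm_apply_eq]
    simp
  rw [h1]
  simp [HolLineBundle.factor]

/-- A functional equation for the lattice follows from the one for generators. -/
theorem forall_add_eq_autFactor_pow_mul {Λ : AddSubgroup CC} {H : CC → CC → ℂ}
    (hH : IsRiemannForm Λ H) {χ : Λ → Circle} (hχ : IsSemiCharacter Λ H χ) {n : ℕ} {F : CC → ℂ}
    {S : Set CC} (hS : AddSubgroup.closure S = Λ)
    (h : ∀ α ∈ S, ∀ (hα : α ∈ Λ) (z : CC), F (z + α) = autFactor H χ ⟨α, hα⟩ z ^ n * F z)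
    {α : CC} (hα : α ∈ Λ) (z : CC) : F (z + α) = autFactor H χ ⟨α, hα⟩ z ^ n * F z := by
  have hzero : ∀ z, autFactor H χ 0 z = 1 := by
    intro z
    have := autFactor_add hH hχ 0 0 z
    rw [add_zero, AddSubgroup.coe_zero, zero_add] at this
    exact (mul_eq_left₀ (autFactor_ne_zero H χ 0 z)).1 this.symm
  have hα' : α ∈ AddSubgroup.closure S := by rwa [hS]
  induction hα' using AddSubgroup.closure_induction generalizing z with
  | mem α hαS => exact h α hαS hα z
  | zero =>
    have : (⟨0, hα⟩ : Λ) = 0 := rfl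
    rw [this, hzero, add_zero, one_pow, one_mul]
  | add α β hα1 hβ1 ihα ihβ =>
    rw [hS] at hα1 hβ1
    have : (⟨α + β, hα⟩ : Λ) = ⟨α, hα1⟩ + ⟨β, hβ1⟩ := rfl
    rw [this, autFactor_add hH hχ, add_comm α β, ← add_assoc, ihα hα1, ihβ hβ1, mul_pow,
      add_comm z β]
    ring
  | neg α hα1 ih =>
    rw [hS] at hα1
    -- The equation for `α` at `z - α` is inverted; the cocycle relation for `α + (-α) = 0`
    -- identifies the inverse factor.
    have h1 := ih hα1 (z + -α)
    have h2 := autFactor_add hH hχ ⟨α, hα1⟩ ⟨-α, hα⟩ z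
    have h3 : (⟨α, hα1⟩ + ⟨-α, hα⟩ : Λ) = 0 := by ext1; simp
    rw [h3, hzero] at h2
    change 1 = autFactor H χ ⟨α, hα1⟩ (-α + z) * autFactor H χ ⟨-α, hα⟩ z at h2
    rw [neg_add_cancel_right] at h1
    rw [h1, ← mul_assoc, ← mul_pow, add_comm z (-α), mul_comm (autFactor _ _ _ z), ← h2, one_pow,
      one_mul]

/-! ### Theta functions for `diag(τ, τ)` -/

section ProductTheta

open Complex

variable {τ : ℂ}

/-- The Gaussian factor relating the classical and the canonical factor of automorphy. -/
noncomputable def gaussian (τ : ℂ) (n : ℕ) (z : ℂ) : ℂ :=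
  cexp (n * (Real.pi * z ^ 2 / (2 * (τ.im : ℂ))))

theorem gaussian_ne_zero (n : ℕ) (z : ℂ) : gaussian τ n z ≠ 0 := Complex.exp_ne_zero _

theorem differentiable_gaussian (n : ℕ) : Differentiable ℂ (gaussian τ n) := by
  unfold gaussian
  fun_prop

theorem autFactor_single {χ : periodLattice (diagPeriod τ) → Circle} {j : Fin 2} {t : ℂ}
    (ht : Pi.single j t ∈ periodLattice (diagPeriod τ)) (z : CC) :
    autFactor (formH τ) χ ⟨Pi.single j t, ht⟩ z = χ ⟨Pi.single j t, ht⟩ *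
      cexp (Real.pi * (z j * conj t) / τ.im + Real.pi / 2 * (t * conj t) / τ.im) := by
  unfold autFactor formH
  congr 2
  fin_cases j <;> simp <;> ring

/-- The increment `(z + 1)² - z² = 2z + 1` is exactly the canonical exponent, so after division the
period `1` retains only a constant multiplier. -/
theorem gaussian_add_one (hτ : 0 < τ.im) (n : ℕ) (z : ℂ) :
    gaussian τ n (z + 1) = cexp (Real.pi * (z * conj 1) / τ.im +
      Real.pi / 2 * (1 * conj 1) / τ.im) ^ n * gaussian τ n z := by
  have h : (τ.im : ℂ) ≠ 0 := by exact_mod_cast hτ.ne'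
  unfold gaussian
  rw [← Complex.exp_nat_mul, ← Complex.exp_add, map_one]
  congr 1
  field_simp
  ring

/-- The Gaussian produces `τ` where the canonical factor has `conj τ = τ - 2i Im τ`; the discrepancy
is the classical factor. -/
theorem gaussian_add_tau (hτ : 0 < τ.im) (n : ℕ) (z : ℂ) :
    gaussian τ n (z + τ) * cexp (-(Real.pi * I * n * (τ + 2 * z))) =
      cexp (Real.pi * (z * conj τ) / τ.im + Real.pi / 2 * (τ * conj τ) / τ.im) ^ n *
        gaussian τ n z := by
  have h : (τ.im : ℂ) ≠ 0 := by exact_mod_cast hτ.ne'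
  have hc : conj τ = τ - 2 * I * τ.im := by
    have := Complex.sub_conj τ
    push_cast at this
    linear_combination -this
  unfold gaussian
  rw [← Complex.exp_nat_mul, ← Complex.exp_add, ← Complex.exp_add, hc]
  congr 1
  field_simp
  ring

theorem exists_exp_two_pi_I_mul_eq {u : ℂ} (hu : u ≠ 0) : ∃ μ, cexp (2 * Real.pi * I * μ) = u := by
  refine ⟨Complex.log u / (2 * Real.pi * I), ?_⟩
  rw [mul_div_cancel₀ _ Complex.two_pi_I_ne_zero, Complex.exp_log hu]

variable {χ : periodLattice (diagPeriod τ) → Circle} {n : ℕ}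
  {M : HolLineBundle (periodLattice (diagPeriod τ))} {μ ν : Fin 2 → ℂ}

theorem add_single_eq_update (w : CC) (j : Fin 2) (z t : ℂ) :
    Function.update w j (z + t) = Function.update w j z + Pi.single j t := by
  ext i
  by_cases h : i = j
  · subst h; simp
  · simp [h]

/-- The restrictions of a theta function to the lines parallel to the coordinate axes are
quasi-periodic. -/
theorem slice_mem_quasiPeriodic (hτ : 0 < τ.im)
    (hfac : ∀ (α : CC) (hα : α ∈ periodLattice (diagPeriod τ)) (z : CC),
      M.factor hα z = autFactor (formH τ) χ ⟨α, hα⟩ z ^ n)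
    (hμ : ∀ j, cexp (2 * Real.pi * I * μ j) =
      (χ ⟨Pi.single j 1, single_one_mem_periodLattice j⟩ : ℂ) ^ n)
    (hν : ∀ j, cexp (2 * Real.pi * I * ν j) =
      (χ ⟨Pi.single j τ, single_tau_mem_periodLattice j⟩ : ℂ) ^ n)
    {F : CC → ℂ} (hF : F ∈ M.thetaFunctions) (j : Fin 2) (w : CC) :
    (fun z => (gaussian τ n z)⁻¹ * F (Function.update w j z)) ∈
      quasiPeriodic τ (cexp (2 * Real.pi * I * μ j)) (cexp (2 * Real.pi * I * ν j)) n := by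
  have hup : Differentiable ℂ fun z => Function.update w j z := fun z =>
    (hasFDerivAt_update w z).differentiableAt
  refine ⟨((differentiable_gaussian n).inv (gaussian_ne_zero n)).mul (hF.1.comp hup),
    fun z => ?_, fun z => ?_⟩
  · have h0 := gaussian_ne_zero (τ := τ) n z
    have h1 := gaussian_ne_zero (τ := τ) n (z + 1)
    simp only
    rw [add_single_eq_update, hF.2 _ (single_one_mem_periodLattice j), hfac, autFactor_single,
      Function.update_self, hμ]
    rw [inv_mul_eq_iff_eq_mul₀ h1, gaussian_add_one hτ, mul_pow]
    have h3 := mul_inv_cancel₀ h0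
    set u : ℂ := (χ ⟨Pi.single j 1, single_one_mem_periodLattice j⟩ : ℂ) ^ n
    linear_combination -(u * cexp (Real.pi * (z * conj 1) / τ.im +
      Real.pi / 2 * (1 * conj 1) / τ.im) ^ n * F (Function.update w j z)) * h3
  · have h0 := gaussian_ne_zero (τ := τ) n z
    have h1 := gaussian_ne_zero (τ := τ) n (z + τ)
    have h2 := gaussian_add_tau hτ n z
    simp only
    rw [add_single_eq_update, hF.2 _ (single_tau_mem_periodLattice j), hfac, autFactor_single,
      Function.update_self, hν]
    rw [inv_mul_eq_iff_eq_mul₀ h1, mul_pow]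
    have h3 := mul_inv_cancel₀ h0
    set u : ℂ := (χ ⟨Pi.single j τ, single_tau_mem_periodLattice j⟩ : ℂ) ^ n
    linear_combination -(u * F (Function.update w j z) * (gaussian τ n z)⁻¹) * h2 -
      u * cexp (Real.pi * (z * conj τ) / τ.im + Real.pi / 2 * (τ * conj τ) / τ.im) ^ n *
        F (Function.update w j z) * h3

/-- A product of quasi-periodic functions of the two coordinates gives a theta function. -/
theorem gaussian_mul_prod_mem_thetaFunctions (hτ : 0 < τ.im)
    (hχ : IsSemiCharacter (periodLattice (diagPeriod τ)) (formH τ) χ)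
    (hfac : ∀ (α : CC) (hα : α ∈ periodLattice (diagPeriod τ)) (z : CC),
      M.factor hα z = autFactor (formH τ) χ ⟨α, hα⟩ z ^ n)
    (hμ : ∀ j, cexp (2 * Real.pi * I * μ j) =
      (χ ⟨Pi.single j 1, single_one_mem_periodLattice j⟩ : ℂ) ^ n)
    (hν : ∀ j, cexp (2 * Real.pi * I * ν j) =
      (χ ⟨Pi.single j τ, single_tau_mem_periodLattice j⟩ : ℂ) ^ n)
    {j i : Fin 2} (hij : i ≠ j) {f g : ℂ → ℂ}
    (hf : f ∈ quasiPeriodic τ (cexp (2 * Real.pi * I * μ j)) (cexp (2 * Real.pi * I * ν j)) n)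
    (hg : g ∈ quasiPeriodic τ (cexp (2 * Real.pi * I * μ i)) (cexp (2 * Real.pi * I * ν i)) n) :
    (fun z : CC => (gaussian τ n (z j) * f (z j)) * (gaussian τ n (z i) * g (z i))) ∈
      M.thetaFunctions := by
  have hG := differentiable_gaussian (τ := τ) n
  -- A generator supported on coordinate `k` moves only the factor in that coordinate, and its
  -- automorphy factor depends on `z k` alone.
  have key : ∀ (k : Fin 2) (h : ℂ → ℂ),
      h ∈ quasiPeriodic τ (cexp (2 * Real.pi * I * μ k)) (cexp (2 * Real.pi * I * ν k)) n →
      (Differentiable ℂ fun z : CC => gaussian τ n (z k) * h (z k)) ∧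
      (∀ z : CC, gaussian τ n (z k + 1) * h (z k + 1) = autFactor (formH τ) χ
        ⟨Pi.single k 1, single_one_mem_periodLattice k⟩ z ^ n * (gaussian τ n (z k) * h (z k))) ∧
      (∀ z : CC, gaussian τ n (z k + τ) * h (z k + τ) = autFactor (formH τ) χ
        ⟨Pi.single k τ, single_tau_mem_periodLattice k⟩ z ^ n *
          (gaussian τ n (z k) * h (z k))) := by
    rintro k h ⟨hd, h1, h2⟩
    refine ⟨(hG.comp (differentiable_apply k)).mul (hd.comp (differentiable_apply k)),
      fun z => ?_, fun z => ?_⟩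
    · rw [h1, autFactor_single, hμ, gaussian_add_one hτ, mul_pow]
      ring
    · rw [h2, autFactor_single, hν, mul_pow]
      linear_combination (χ ⟨Pi.single k τ, single_tau_mem_periodLattice k⟩ : ℂ) ^ n * h (z k) *
        gaussian_add_tau hτ n (z k)
  obtain ⟨hfd, hf1, hf2⟩ := key j f hf
  obtain ⟨hgd, hg1, hg2⟩ := key i g hg
  refine ⟨hfd.mul hgd, fun α hα z => ?_⟩
  rw [hfac]
  refine forall_add_eq_autFactor_pow_mul (isRiemannForm_formH hτ) hχ
    (F := fun z : CC => (gaussian τ n (z j) * f (z j)) * (gaussian τ n (z i) * g (z i)))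
    (S := {α | ∃ k, α = Pi.single k 1 ∨ α = Pi.single k τ}) ?_ ?_ hα z
  · rw [← closure_latticeBasis]
    congr 1
    rw [latticeBasis_eq]
    ext α
    simp only [Set.mem_ofPred_eq, Set.mem_range, Fin.exists_fin_succ]
    simp only [Matrix.cons_val_zero, Matrix.cons_val_succ, IsEmpty.exists_iff, or_false]
    constructor
    · rintro ((rfl | rfl) | (rfl | rfl)) <;> simp
    · rintro (rfl | rfl | rfl | rfl) <;> simp
  · rintro α ⟨k, hk⟩ hα z
    have hk' : k = j ∨ k = i := by
      fin_cases j <;> fin_cases i <;> fin_cases k <;> simp_all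
    rcases hk' with rfl | rfl <;> rcases hk with rfl | rfl
    · simp only [Pi.add_apply, Pi.single_eq_same, Pi.single_eq_of_ne hij, add_zero]
      rw [hf1]; ring
    · simp only [Pi.add_apply, Pi.single_eq_same, Pi.single_eq_of_ne hij, add_zero]
      rw [hf2]; ring
    · simp only [Pi.add_apply, Pi.single_eq_same, Pi.single_eq_of_ne hij.symm, add_zero]
      rw [hg1]; ring
    · simp only [Pi.add_apply, Pi.single_eq_same, Pi.single_eq_of_ne hij.symm, add_zero]
      rw [hg2]; ring

/-! ### Dimension bounds by slicing. -/

/-- The restriction of theta functions to a line parallel to a coordinate axis. -/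
noncomputable def slice (τ : ℂ) (n : ℕ) (V : Submodule ℂ (CC → ℂ)) (W : Submodule ℂ (ℂ → ℂ))
    (j : Fin 2) (w : CC)
    (h : ∀ F ∈ V, (fun z => (gaussian τ n z)⁻¹ * F (Function.update w j z)) ∈ W) : V →ₗ[ℂ] W where
  toFun F := ⟨fun z => (gaussian τ n z)⁻¹ * (F : CC → ℂ) (Function.update w j z), h F F.2⟩
  map_add' F G := by ext z; simp [mul_add]
  map_smul' c F := by ext z; simp; ring

/-- A finite-dimensional space of functions is separated by finitely many points. -/
theorem exists_finset_forall_eq_zero {X : Type*} (W : Submodule ℂ (X → ℂ))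
    [FiniteDimensional ℂ W] : ∃ P : Finset X, ∀ g ∈ W, (∀ p ∈ P, g p = 0) → g = 0 := by
  classical
  let K : Finset X → Submodule ℂ W := fun P =>
    { carrier := {g | ∀ p ∈ P, (g : X → ℂ) p = 0}
      zero_mem' := by simp
      add_mem' := fun {f g} hf hg p hp => by
        rw [Submodule.coe_add, Pi.add_apply, hf p hp, hg p hp, add_zero]
      smul_mem' := fun c f hf p hp => by
        rw [Submodule.coe_smul, Pi.smul_apply, hf p hp, smul_zero] }
  -- A minimal common kernel must be zero: a point where one of its members is nonzero, added to
  -- `P`, would shrink it.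
  obtain ⟨_, ⟨P, rfl⟩, hP⟩ := IsArtinian.set_has_minimal (R := ℂ) (Set.range K) ⟨_, ∅, rfl⟩
  refine ⟨P, fun g hg hgP => ?_⟩
  funext x
  by_contra hx
  refine hP (K (insert x P)) ⟨_, rfl⟩ (lt_of_le_of_ne (fun f hf p hp => ?_) fun h => hx ?_)
  · exact hf p (Finset.mem_insert_of_mem hp)
  · have h1 : (⟨g, hg⟩ : W) ∈ K P := hgP
    rw [← h] at h1
    exact h1 x (Finset.mem_insert_self x P)

theorem update_update_self_eq (z : CC) :
    Function.update (Function.update (0 : CC) 1 (z 1)) 0 (z 0) = z := by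
  ext i
  fin_cases i <;> simp

theorem update_zero_update_one (a b : ℂ) :
    Function.update (Function.update (0 : CC) 0 a) 1 b =
      Function.update (Function.update (0 : CC) 1 b) 0 a := by
  ext i
  fin_cases i <;> simp

/-- Theta functions vanish if enough of their slices do. -/
theorem eq_zero_of_slice_eq_zero {V : Submodule ℂ (CC → ℂ)} {W : Submodule ℂ (ℂ → ℂ)}
    (h : ∀ F ∈ V, ∀ w, (fun z => (gaussian τ n z)⁻¹ * F (Function.update w 0 z)) ∈ W)
    {P : Set ℂ} (hP : ∀ g ∈ W, (∀ p ∈ P, g p = 0) → g = 0) {F : CC → ℂ} (hF : F ∈ V)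
    (hFP : ∀ p ∈ P, ∀ z, F (Function.update (Function.update 0 0 p) 1 z) = 0) : F = 0 := by
  funext z
  have h1 := hP _ (h F hF (Function.update 0 1 (z 1))) (fun p hp => by
    rw [← update_zero_update_one, hFP p hp, mul_zero])
  have h2 := congrFun h1 (z 0)
  simp only [update_update_self_eq, Pi.zero_apply, mul_eq_zero, inv_eq_zero,
    gaussian_ne_zero, false_or] at h2
  exact h2

/-- Finitely many points separate `W`, so a function in `V` is determined by its slices in the
second variable over these points; thus `V` embeds into a finite power of `W'`. -/
theorem finiteDimensional_of_slices {V : Submodule ℂ (CC → ℂ)} {W W' : Submodule ℂ (ℂ → ℂ)}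
    [FiniteDimensional ℂ W] [FiniteDimensional ℂ W']
    (h : ∀ F ∈ V, ∀ w, (fun z => (gaussian τ n z)⁻¹ * F (Function.update w 0 z)) ∈ W)
    (h' : ∀ F ∈ V, ∀ w, (fun z => (gaussian τ n z)⁻¹ * F (Function.update w 1 z)) ∈ W') :
    FiniteDimensional ℂ V := by
  obtain ⟨P, hP⟩ := exists_finset_forall_eq_zero W
  let φ : V →ₗ[ℂ] (P → W') := LinearMap.pi fun p =>
    slice τ n V W' 1 (Function.update 0 0 p) fun F hF => h' F hF _
  refine FiniteDimensional.of_injective φ ?_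
  rw [injective_iff_map_eq_zero]
  intro F hF
  refine Subtype.ext (eq_zero_of_slice_eq_zero h (P := P) hP F.2 fun p hp z => ?_)
  have h2 := congrFun (congrArg Subtype.val (congrFun hF ⟨p, hp⟩)) z
  change (gaussian τ n z)⁻¹ * F.1 _ = 0 at h2
  simpa [gaussian_ne_zero] using h2

/-- Here the single point `p` separates `W`, so one slice embeds `V` into `W'`. -/
theorem finrank_le_one_of_slices {V : Submodule ℂ (CC → ℂ)} {W W' : Submodule ℂ (ℂ → ℂ)}
    [FiniteDimensional ℂ W] [FiniteDimensional ℂ W'] (hW : Module.finrank ℂ W ≤ 1)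
    (hW' : Module.finrank ℂ W' ≤ 1) {g : ℂ → ℂ} (hg : g ∈ W) {p : ℂ} (hp : g p ≠ 0)
    (h : ∀ F ∈ V, ∀ w, (fun z => (gaussian τ n z)⁻¹ * F (Function.update w 0 z)) ∈ W)
    (h' : ∀ F ∈ V, ∀ w, (fun z => (gaussian τ n z)⁻¹ * F (Function.update w 1 z)) ∈ W') :
    Module.finrank ℂ V ≤ 1 := by
  have hP : ∀ f ∈ W, (∀ q ∈ ({p} : Set ℂ), f q = 0) → f = 0 := by
    intro f hf hfp
    have hg0 : (⟨g, hg⟩ : W) ≠ 0 := fun h0 => hp (congrFun (congrArg Subtype.val h0) p)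
    obtain ⟨v, hv⟩ := finrank_le_one_iff.1 hW
    obtain ⟨c, hc⟩ := hv ⟨g, hg⟩
    obtain ⟨d, hd⟩ := hv ⟨f, hf⟩
    have h1 := congrFun (congrArg Subtype.val hc) p
    have h2 := congrFun (congrArg Subtype.val hd) p
    simp only [Submodule.coe_smul, Pi.smul_apply, smul_eq_mul] at h1 h2
    rw [hfp p rfl] at h2
    have hvp : v.1 p ≠ 0 := fun h0 => hp (by rw [← h1, h0, mul_zero])
    have hd0 : d = 0 := (mul_eq_zero.1 h2).resolve_right hvp
    rw [hd0, zero_smul] at hd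
    exact congrArg Subtype.val hd.symm
  have hinj : Function.Injective
      (slice τ n V W' 1 (Function.update 0 0 p) fun F hF => h' F hF _) := by
    rw [injective_iff_map_eq_zero]
    intro F hF
    refine Subtype.ext (eq_zero_of_slice_eq_zero h hP F.2 ?_)
    rintro q rfl z
    have h2 := congrFun (congrArg Subtype.val hF) z
    change (gaussian τ n z)⁻¹ * F.1 _ = 0 at h2
    simpa [gaussian_ne_zero] using h2
  exact (LinearMap.finrank_le_finrank_of_injective hinj).trans hW'

/-! ### Very ampleness for `n ≥ 3` and the dimension for `n = 1`. -/

theorem exists_multipliers (χ : periodLattice (diagPeriod τ) → Circle) (n : ℕ) :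
    ∃ μ ν : Fin 2 → ℂ, (∀ j, cexp (2 * Real.pi * I * μ j) =
        (χ ⟨Pi.single j 1, single_one_mem_periodLattice j⟩ : ℂ) ^ n) ∧
      ∀ j, cexp (2 * Real.pi * I * ν j) =
        (χ ⟨Pi.single j τ, single_tau_mem_periodLattice j⟩ : ℂ) ^ n := by
  choose μ hμ using fun j : Fin 2 => exists_exp_two_pi_I_mul_eq (pow_ne_zero n
    (Circle.coe_ne_zero (χ ⟨Pi.single j 1, single_one_mem_periodLattice j⟩)))
  choose ν hν using fun j : Fin 2 => exists_exp_two_pi_I_mul_eq (pow_ne_zero n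
    (Circle.coe_ne_zero (χ ⟨Pi.single j τ, single_tau_mem_periodLattice j⟩)))
  exact ⟨μ, ν, hμ, hν⟩

theorem exists_ne_of_fin_two (j : Fin 2) : ∃ i : Fin 2, i ≠ j := ⟨j + 1, by fin_cases j <;> simp⟩

/-- Each coordinate `j` is treated separately: in the products, `g` is fixed in the other coordinate
with `g (z i) ≠ 0`, and `f` varies over the whole one-variable space. -/
theorem isVeryAmple_of_three_le (hτ : 0 < τ.im)
    (hχ : IsSemiCharacter (periodLattice (diagPeriod τ)) (formH τ) χ) (hn : 3 ≤ n)
    (hfac : ∀ (α : CC) (hα : α ∈ periodLattice (diagPeriod τ)) (z : CC),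
      M.factor hα z = autFactor (formH τ) χ ⟨α, hα⟩ z ^ n) : M.IsVeryAmple := by
  obtain ⟨μ, ν, hμ, hν⟩ := exists_multipliers χ n
  have hn0 : 0 < n := by omega
  have hW : ∀ j, FiniteDimensional ℂ (quasiPeriodic τ (cexp (2 * Real.pi * I * μ j))
      (cexp (2 * Real.pi * I * ν j)) n) := fun j =>
    (quasiPeriodic_finite (Complex.exp_ne_zero _) hn0).1
  have hV : FiniteDimensional ℂ M.thetaFunctions :=
    finiteDimensional_of_slices
      (fun F hF w => slice_mem_quasiPeriodic hτ hfac hμ hν hF 0 w)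
      (fun F hF w => slice_mem_quasiPeriodic hτ hfac hμ hν hF 1 w)
  have hC := compactSpace_quotient hτ
  have hG := gaussian_ne_zero (τ := τ) n
  refine M.isVeryAmple_of_separates ?_ ?_ ?_
  · intro z
    obtain ⟨f, hf, hf0⟩ := exists_quasiPeriodic_ne_zero (μ := μ 0) (ν := ν 0) hτ hn (z 0)
    obtain ⟨g, hg, hg0⟩ := exists_quasiPeriodic_ne_zero (μ := μ 1) (ν := ν 1) hτ hn (z 1)
    exact ⟨_, gaussian_mul_prod_mem_thetaFunctions hτ hχ hfac hμ hν one_ne_zero hf hg,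
      mul_ne_zero (mul_ne_zero (hG _) hf0) (mul_ne_zero (hG _) hg0)⟩
  · intro z w c hc h
    rw [mem_periodLattice_diagPeriod]
    intro j
    obtain ⟨i, hij⟩ := exists_ne_of_fin_two j
    obtain ⟨f, hf, hf0⟩ := exists_quasiPeriodic_ne_zero (μ := μ j) (ν := ν j) hτ hn (z j)
    obtain ⟨g, hg, hg0⟩ := exists_quasiPeriodic_ne_zero (μ := μ i) (ν := ν i) hτ hn (z i)
    have h' := fun f hf => h _ (gaussian_mul_prod_mem_thetaFunctions hτ hχ hfac hμ hν hij
      (f := f) hf hg)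
    have hA : gaussian τ n (z i) * g (z i) ≠ 0 := mul_ne_zero (hG _) hg0
    -- Otherwise every product would vanish at `w`, hence at `z`, whereas `f` was chosen nonzero at
    -- `z j`.
    have hB : gaussian τ n (w i) * g (w i) ≠ 0 := by
      intro h0
      have := h' f hf
      rw [h0, mul_zero, mul_zero] at this
      exact mul_ne_zero (mul_ne_zero (hG _) hf0) hA this
    refine exists_int_of_quasiPeriodic_proportional (μ := μ j) (ν := ν j) hτ hn
      (c := c * gaussian τ n (w j) * (gaussian τ n (w i) * g (w i)) /
        (gaussian τ n (z j) * (gaussian τ n (z i) * g (z i))))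
      (div_ne_zero (mul_ne_zero (mul_ne_zero hc (hG _)) hB) (mul_ne_zero (hG _) hA))
      fun f hf => ?_
    rw [div_mul_eq_mul_div, eq_div_iff (mul_ne_zero (hG _) hA)]
    linear_combination h' f hf
  · intro z u c h
    funext j
    obtain ⟨i, hij⟩ := exists_ne_of_fin_two j
    obtain ⟨g, hg, hg0⟩ := exists_quasiPeriodic_ne_zero (μ := μ i) (ν := ν i) hτ hn (z i)
    have hA : gaussian τ n (z i) * g (z i) ≠ 0 := mul_ne_zero (hG _) hg0
    have hproj : ∀ k : Fin 2, HasFDerivAt (fun z : CC => z k)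
        (ContinuousLinearMap.proj (R := ℂ) (φ := fun _ : Fin 2 => ℂ) k) z := fun k =>
      (ContinuousLinearMap.proj (R := ℂ) (φ := fun _ : Fin 2 => ℂ) k).hasFDerivAt
    have hd : ∀ (k : Fin 2) (f : ℂ → ℂ), Differentiable ℂ f →
        HasFDerivAt (fun z : CC => gaussian τ n (z k) * f (z k))
          ((deriv (gaussian τ n) (z k) * f (z k) + gaussian τ n (z k) * deriv f (z k)) •
            ContinuousLinearMap.proj (R := ℂ) (φ := fun _ : Fin 2 => ℂ) k) z := by
      intro k f hf
      have h1 := ((differentiable_gaussian (τ := τ) n) (z k)).hasDerivAt.mul (hf (z k)).hasDerivAt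
      exact h1.comp_hasFDerivAt z (hproj k)
    -- The constant is `c` minus the logarithmic derivatives along `u` of the Gaussian in coordinate
    -- `j` and of the fixed factor in coordinate `i`.
    refine eq_zero_of_quasiPeriodic_deriv (μ := μ j) (ν := ν j) hτ hn (x := z j)
      (c := c - deriv (gaussian τ n) (z j) / gaussian τ n (z j) * u j -
        (deriv (gaussian τ n) (z i) * g (z i) + gaussian τ n (z i) * deriv g (z i)) * u i /
          (gaussian τ n (z i) * g (z i))) fun f hf => ?_
    have h1 := h _ (gaussian_mul_prod_mem_thetaFunctions hτ hχ hfac hμ hν hij hf hg)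
    have h2 := ((hd j f hf.1).mul (hd i g hg.1)).fderiv
    change fderiv ℂ (fun z : CC => (gaussian τ n (z j) * f (z j)) *
      (gaussian τ n (z i) * g (z i))) z = _ at h2
    rw [h2] at h1
    simp only [add_apply, smul_apply,
      ContinuousLinearMap.proj_apply, smul_eq_mul] at h1
    have hGj := hG (z j)
    have hGi := hG (z i)
    field_simp
    linear_combination h1

theorem finrank_thetaFunctions_eq_one (hτ : 0 < τ.im)
    (hχ : IsSemiCharacter (periodLattice (diagPeriod τ)) (formH τ) χ)
    (hfac : ∀ (α : CC) (hα : α ∈ periodLattice (diagPeriod τ)) (z : CC),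
      M.factor hα z = autFactor (formH τ) χ ⟨α, hα⟩ z ^ 1) :
    Module.finrank ℂ M.thetaFunctions = 1 := by
  obtain ⟨μ, ν, hμ, hν⟩ := exists_multipliers χ 1
  have hW := fun j => quasiPeriodic_finite (τ := τ) (μ := μ j)
    (Complex.exp_ne_zero (2 * Real.pi * I * ν j)) one_pos
  have hW0 := (hW 0).1
  have hW1 := (hW 1).1
  have h0 : ∀ F ∈ M.thetaFunctions, ∀ w, _ := fun F hF w =>
    slice_mem_quasiPeriodic hτ hfac hμ hν hF 0 w
  have h1 : ∀ F ∈ M.thetaFunctions, ∀ w, _ := fun F hF w =>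
    slice_mem_quasiPeriodic hτ hfac hμ hν hF 1 w
  obtain ⟨f, hf, p, hp⟩ := exists_mem_quasiPeriodic_one_ne_zero hτ (μ 0) (ν 0)
  obtain ⟨g, hg, q, hq⟩ := exists_mem_quasiPeriodic_one_ne_zero hτ (μ 1) (ν 1)
  have hV := finiteDimensional_of_slices h0 h1
  refine le_antisymm (finrank_le_one_of_slices (hW 0).2 (hW 1).2 hf hp h0 h1) ?_
  have hF := gaussian_mul_prod_mem_thetaFunctions hτ hχ hfac hμ hν one_ne_zero hf hg
  have : Nontrivial M.thetaFunctions := by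
    refine ⟨⟨_, hF⟩, 0, fun h => ?_⟩
    have := congrFun (congrArg Subtype.val h) ![p, q]
    exact mul_ne_zero (mul_ne_zero (gaussian_ne_zero (τ := τ) 1 p) hp)
      (mul_ne_zero (gaussian_ne_zero (τ := τ) 1 q) hq) this
  exact Module.finrank_pos

end ProductTheta

theorem theorem3p3 (τ : ℂ) (hτ : 0 < τ.im) :
    -- the vectors `f₁, …, f₄` form a `ℤ`-basis of `L_Ω`, which is a lattice in `ℂ²`
    (LinearIndependent ℝ (latticeBasis τ) ∧
      AddSubgroup.closure (Set.range (latticeBasis τ)) = periodLattice (diagPeriod τ)) ∧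
    -- the matrix of `E_τ = Im H_τ` in this basis
    (Matrix.of fun i j => (formH τ (latticeBasis τ i) (latticeBasis τ j)).im) =
      !![0, 0, 1, 0;
         0, 0, 0, 1;
         -1, 0, 0, 0;
         0, -1, 0, 0] ∧
    IsPosDefForm (formH τ) ∧
    ∃ hH : IsRiemannForm (periodLattice (diagPeriod τ)) (formH τ),
      (∃ χ, IsSemiCharacter (periodLattice (diagPeriod τ)) (formH τ) χ) ∧
      ∀ (χ : periodLattice (diagPeriod τ) → Circle)
        (hχ : IsSemiCharacter (periodLattice (diagPeriod τ)) (formH τ) χ),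
        (lineBundle hH hχ).IsAmple ∧
        (∀ n : ℕ, 3 ≤ n → ((lineBundle hH hχ).tensorPower n).IsVeryAmple) ∧
        Module.finrank ℂ (lineBundle hH hχ).sections = 1 := by
  refine ⟨⟨linearIndependent_latticeBasis hτ, closure_latticeBasis⟩, formH_latticeBasis_im hτ,
    isPosDefForm_formH hτ, isRiemannForm_formH hτ, exists_isSemiCharacter hτ, fun χ hχ => ?_⟩
  have hva : ∀ n : ℕ, 3 ≤ n →
      ((lineBundle (isRiemannForm_formH hτ) hχ).tensorPower n).IsVeryAmple := fun n hn =>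
    isVeryAmple_of_three_le hτ hχ hn fun α hα z => by
      rw [factor_tensorPower, factor_lineBundle]
  refine ⟨⟨3, by norm_num, hva 3 le_rfl⟩, hva, ?_⟩
  rw [(lineBundle (isRiemannForm_formH hτ) hχ).sectionsEquiv.finrank_eq]
  exact finrank_thetaFunctions_eq_one hτ hχ fun α hα z => by rw [factor_lineBundle, pow_one]
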